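/- Let $d\ge 3$, $0<c<c_*:=\frac{(d-2)^2}{4}$ and $2^*:=\frac{2d}{d-2}$. For a complex-valued $u\in H^1(\mathbb R^d)$ put $$H(u):=\int_{\mathbb R^d}|\nabla u|^2\,dx-c\int_{\mathbb R^d}\frac{|u|^2}{|x|^2}\,dx .$$ Let $\{v_n\}_{n=1}^\infty$ be a bounded sequence in $H^1(\mathbb R^d)$. Then there exist a subsequence of $\{v_n\}_{n=1}^\infty$ (still denoted $\{v_n\}_{n=1}^\infty$), a family $\{\mathbf x^j\}_{j=1}^\infty$ of sequences $\mathbf x^j=\{x_n^j\}_{n=1}^\infty$ in $\mathbb R^d$ and a sequence $\{V^j\}_{j=1}^\infty$ of functions in $H^1(\mathbb R^d)$ such that i) for every $k\neq j$, $|x_n^k-x_n^j|\to+\infty$ as $n\to\infty$; ii) for every $\ell\ge 1$, every $n\ge 1$ and every $x\in\mathbb R^d$, $$v_n(x)=\sum_{j=1}^{\ell}V^j(x-x_n^j)+v_n^\ell(x),$$ with $v_n^\ell\in H^1(\mathbb R^d)$ and, for every $p\in(2,2^*)$, $$\lim_{\ell\to\infty}\ \limsup_{n\to\infty}\|v_n^\ell\|_{L^p(\mathbb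 R^d)}=0 .$$ Moreover, for every $\ell\ge1$, as $n\to\infty$, $$\|v_n\|_{L^2}^2=\sum_{j=1}^{\ell}\|V^j\|_{L^2}^2+\|v_n^\ell\|_{L^2}^2+o(1)$$ and $$H(v_n)=\sum_{j=1}^{\ell}H\big(V^j(\cdot-x_n^j)\big)+H(v_n^\ell)+o(1).$$ -/

import Mathlib

open MeasureTheory Filter Topology
open scoped ContDiff

noncomputable section

/-- `g` is the weak gradient of `u : ℝᵈ → ℂ`: both are locally integrable, and
`∫ u ∂ᵢψ = - ∫ gᵢ ψ` for every test function `ψ ∈ C_c^∞(ℝᵈ)` and every coordinate `i`. -/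
def HasWeakGradient {d : ℕ} (u : EuclideanSpace ℝ (Fin d) → ℂ)
    (g : EuclideanSpace ℝ (Fin d) → EuclideanSpace ℂ (Fin d)) : Prop :=
  LocallyIntegrable u volume ∧ LocallyIntegrable g volume ∧
    ∀ ψ : EuclideanSpace ℝ (Fin d) → ℝ, ContDiff ℝ ∞ ψ → HasCompactSupport ψ → ∀ i : Fin d,
      ∫ x, (fderiv ℝ ψ x (EuclideanSpace.single i 1)) • u x = -∫ x, ψ x • g x i

/-- Weak gradients are unique up to a null set. -/
theorem HasWeakGradient.ae_unique {d : ℕ} {u : EuclideanSpace ℝ (Fin d) → ℂ}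
    {g h : EuclideanSpace ℝ (Fin d) → EuclideanSpace ℂ (Fin d)}
    (hg : HasWeakGradient u g) (hh : HasWeakGradient u h) : g =ᵐ[volume] h := by
  have coord : ∀ f : EuclideanSpace ℝ (Fin d) → EuclideanSpace ℂ (Fin d),
      LocallyIntegrable f volume → ∀ i : Fin d, LocallyIntegrable (fun x => f x i) volume := by
    intro f hf i x
    obtain ⟨s, hs, hfs⟩ := hf x
    exact ⟨s, hs, (EuclideanSpace.proj i : EuclideanSpace ℂ (Fin d) →L[ℂ] ℂ).integrable_comp hfs⟩
  have key : ∀ i : Fin d, ∀ᵐ x ∂(volume : Measure (EuclideanSpace ℝ (Fin d))),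
      g x i = h x i := by
    intro i
    refine ae_eq_of_integral_contDiff_smul_eq (coord g hg.2.1 i) (coord h hh.2.1 i) ?_
    intro ψ hψ hc
    have e1 := hg.2.2 ψ hψ hc i
    have e2 := hh.2.2 ψ hψ hc i
    exact neg_injective (e1.symm.trans e2)
  filter_upwards [ae_all_iff.2 key] with x hx
  ext i
  exact hx i

/-- `u ∈ H¹(ℝᵈ)`: `u` is in `L²` and has a weak gradient in `L²`. -/
def MemH1 {d : ℕ} (u : EuclideanSpace ℝ (Fin d) → ℂ) : Prop :=
  MemLp u 2 volume ∧ ∃ g, HasWeakGradient u g ∧ MemLp g 2 volume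

open Classical in
/-- The weak gradient `∇u` (well defined almost everywhere) of a function that has one; it is `0`
by convention for other functions. -/
def weakGradient {d : ℕ} (u : EuclideanSpace ℝ (Fin d) → ℂ) :
    EuclideanSpace ℝ (Fin d) → EuclideanSpace ℂ (Fin d) :=
  if h : ∃ g, HasWeakGradient u g then h.choose else 0

theorem hasWeakGradient_weakGradient {d : ℕ} {u : EuclideanSpace ℝ (Fin d) → ℂ}
    (h : ∃ g, HasWeakGradient u g) : HasWeakGradient u (weakGradient u) := by
  rw [weakGradient, dif_pos h]
  exact h.choose_spec

theorem MemH1.memLp_weakGradient {d : ℕ} {u : EuclideanSpace ℝ (Fin d) → ℂ} (hu : MemH1 u) :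
    MemLp (weakGradient u) 2 volume := by
  obtain ⟨-, g, hg, hg2⟩ := hu
  exact (memLp_congr_ae ((hasWeakGradient_weakGradient ⟨g, hg⟩).ae_unique hg)).2 hg2

/-- The `H¹` norm `(‖u‖²_{L²} + ‖∇u‖²_{L²})^{1/2}`. -/
def h1Norm {d : ℕ} (u : EuclideanSpace ℝ (Fin d) → ℂ) : ℝ :=
  Real.sqrt ((∫ x, ‖u x‖ ^ 2) + ∫ x, ‖weakGradient u x‖ ^ 2)

/-- The Hardy functional `H(u) = ∫ |∇u|² - c ∫ |u|² / |x|²`. -/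
def hardyFunctional {d : ℕ} (c : ℝ) (u : EuclideanSpace ℝ (Fin d) → ℂ) : ℝ :=
  (∫ x, ‖weakGradient u x‖ ^ 2) - c * ∫ x, ‖u x‖ ^ 2 / ‖x‖ ^ 2

end

/-!
# Profile decomposition for bounded sequences in `H¹(ℝᵈ)`

The space `H¹(ℝᵈ)` is realised as a Hilbert space `sobolevH1 d` on which `ℝᵈ` acts by translations.
The only properties of this action that matter for the extraction of profiles are collected in the
structure `VanishingAction`: it is isometric, strongly continuous, and translates going to infinity
converge weakly to `0`.

Limits are taken along a nonprincipal ultrafilter, along which every bounded sequence has a weak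
limit and every sequence of translation parameters either converges or goes to infinity. A greedy
choice picks, at each stage, a frame diverging from all the earlier ones in which the weak limit of
the current remainder is at least half as large as in any other such frame. The squared norms of the
profiles are summable because the norm decouples, so the profiles tend to `0`; by almost maximality,
the remainders then vanish uniformly over all frames when tested against any fixed vector
(`VanishingAction.exists_profile_decomposition`). Since only countably many limits are involved, a
single subsequence realises all of them
(`VanishingAction.exists_subsequence_profile_decomposition`).

A quadratic form `‖A u‖²` is asymptotically additive over the decomposition as soon as `A` sends a
moving profile and the remainder to asymptotically orthogonal vectors. This holds for the inclusion
in `L²` and for the gradient because they commute with translations. The operator `u ↦ u / |x|`,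
bounded by Hardy's inequality, does not commute with them, but it kills translates going to infinity
(`sobolevH1.tendsto_hardyOp_translate`), while along bounded translations the remainder already
vanishes weakly without recentring. The functional `H` is a combination of two such forms. Only the
boundedness of `u ↦ u / |x|` enters, so neither the sharp constant in Hardy's inequality nor the
coercivity of `H` is needed.

Convergence of the remainders in `Lᵖ` for `2 < p < 2d / (d - 2)` comes from mollification. Testing
against a bump function shows that the mollified remainder is uniformly small, hence small in `Lᵖ`
by its `L²` bound. The error of mollification at scale `r` is `O(r)` in `L²` and bounded in the
critical space by Sobolev's inequality, hence small in `Lᵖ` by interpolation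
(`HasWeakGradient.exists_eLpNorm_le`).
-/

noncomputable section

open scoped InnerProductSpace ENNReal

/-! ### Weak convergence along filters -/

section WeakConvergence

variable {ι E F : Type*} [NormedAddCommGroup E] [InnerProductSpace ℂ E]
  [NormedAddCommGroup F] [InnerProductSpace ℂ F]

/-- `w n` converges weakly to `V` along the filter `l` in a complex inner product space. -/
def WeakTendsto (w : ι → E) (l : Filter ι) (V : E) : Prop :=
  ∀ f : E, Tendsto (fun n => ⟪f, w n⟫_ℂ) l (𝓝 ⟪f, V⟫_ℂ)

theorem WeakTendsto.sub {w w' : ι → E} {l : Filter ι} {V V' : E} (h : WeakTendsto w l V)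
    (h' : WeakTendsto w' l V') : WeakTendsto (fun n => w n - w' n) l (V - V') := by
  intro f
  simpa only [inner_sub_right] using (h f).sub (h' f)

theorem weakTendsto_const (l : Filter ι) (V : E) : WeakTendsto (fun _ => V) l V :=
  fun _ => tendsto_const_nhds

theorem WeakTendsto.unique {w : ι → E} {l : Filter ι} [l.NeBot] {V V' : E}
    (h : WeakTendsto w l V) (h' : WeakTendsto w l V') : V = V' :=
  ext_inner_left ℂ fun f => tendsto_nhds_unique (h f) (h' f)

theorem WeakTendsto.map [CompleteSpace E] [CompleteSpace F] {w : ι → E} {l : Filter ι} {V : E}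
    (h : WeakTendsto w l V) (A : E →L[ℂ] F) : WeakTendsto (fun n => A (w n)) l (A V) := by
  intro f
  simpa only [ContinuousLinearMap.adjoint_inner_left] using
    h (ContinuousLinearMap.adjoint A f)

theorem WeakTendsto.norm_le {w : ι → E} {l : Filter ι} [l.NeBot] {V : E}
    (h : WeakTendsto w l V) {M : ℝ} (hM : ∀ n, ‖w n‖ ≤ M) : ‖V‖ ≤ M := by
  have h1 : ‖⟪V, V⟫_ℂ‖ ≤ ‖V‖ * M :=
    le_of_tendsto (h V).norm (Eventually.of_forall fun n =>
      (norm_inner_le_norm V (w n)).trans (mul_le_mul_of_nonneg_left (hM n) (norm_nonneg _)))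
  have h2 : ‖⟪V, V⟫_ℂ‖ = ‖V‖ * ‖V‖ := by
    rw [inner_self_eq_norm_sq_to_K]
    simp [sq]
  rw [h2] at h1
  rcases (norm_nonneg V).eq_or_lt with h0 | h0
  · obtain ⟨n⟩ : Nonempty ι := l.nonempty_of_neBot
    rw [← h0]
    exact (norm_nonneg _).trans (hM n)
  · exact le_of_mul_le_mul_left h1 h0

/-- Pairing a strongly convergent family with a bounded weakly convergent one. -/
theorem WeakTendsto.inner_of_tendsto {w f : ι → E} {l : Filter ι} {V g : E}
    (h : WeakTendsto w l V) {M : ℝ} (hM : ∀ n, ‖w n‖ ≤ M) (hf : Tendsto f l (𝓝 g)) :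
    Tendsto (fun n => ⟪f n, w n⟫_ℂ) l (𝓝 ⟪g, V⟫_ℂ) := by
  have h1 : Tendsto (fun n => ⟪f n - g, w n⟫_ℂ) l (𝓝 0) := by
    refine squeeze_zero_norm (a := fun n => ‖f n - g‖ * M) (fun n => ?_) ?_
    · exact (norm_inner_le_norm _ _).trans (mul_le_mul_of_nonneg_left (hM n) (norm_nonneg _))
    · have := (tendsto_iff_norm_sub_tendsto_zero.1 hf).mul_const M
      simpa using this
  have h2 := h1.add (h g)
  simpa only [inner_sub_left, sub_add_cancel, zero_add] using h2

/-- Along an ultrafilter every bounded family in a Hilbert space has a weak limit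
(Banach–Alaoglu). -/
theorem exists_weakTendsto [CompleteSpace E] (U : Ultrafilter ι) {w : ι → E} {M : ℝ}
    (hM : ∀ n, ‖w n‖ ≤ M) : ∃ V, WeakTendsto w U V := by
  let g : ι → WeakDual ℂ E := fun n =>
    StrongDual.toWeakDual (InnerProductSpace.toDual ℂ E (w n))
  have hc : IsCompact (WeakDual.toStrongDual ⁻¹' Metric.closedBall (0 : StrongDual ℂ E) M) :=
    WeakDual.isCompact_closedBall 0 M
  have hg : ∀ n, g n ∈ (WeakDual.toStrongDual ⁻¹' Metric.closedBall (0 : StrongDual ℂ E) M) := by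
    intro n
    have : ‖InnerProductSpace.toDual ℂ E (w n)‖ ≤ M := by
      simpa using hM n
    simpa [g, dist_zero_right] using this
  obtain ⟨Λ, -, hΛ⟩ := hc.ultrafilter_le_nhds (U.map g)
    (le_principal_iff.2 (Filter.mem_map.2 (Filter.univ_mem' hg)))
  refine ⟨(InnerProductSpace.toDual ℂ E).symm (WeakDual.toStrongDual Λ), fun f => ?_⟩
  have h1 : Tendsto (fun n => g n f) U (𝓝 (Λ f)) :=
    ((WeakDual.eval_continuous f).tendsto Λ).comp hΛ
  have h2 := (Complex.continuous_conj.tendsto _).comp h1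
  have e1 : ∀ n, (starRingEnd ℂ) (g n f) = ⟪f, w n⟫_ℂ := by
    intro n
    simp [g, InnerProductSpace.toDual_apply_apply]
  have e2 : (starRingEnd ℂ) (Λ f) =
      ⟪f, (InnerProductSpace.toDual ℂ E).symm (WeakDual.toStrongDual Λ)⟫_ℂ := by
    rw [← inner_conj_symm, InnerProductSpace.toDual_symm_apply]
    rfl
  rw [← e2]
  exact h2.congr e1

/-- Along an ultrafilter, a family of points of a proper space either converges or leaves every
bounded set. -/
theorem ultrafilter_tendsto_cobounded_or_nhds {X : Type*} [PseudoMetricSpace X] [ProperSpace X]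
    (U : Ultrafilter ι) (z : ι → X) :
    Tendsto z U (Bornology.cobounded X) ∨ ∃ a, Tendsto z U (𝓝 a) := by
  by_cases h : Tendsto z U (Bornology.cobounded X)
  · exact Or.inl h
  · right
    rw [Filter.Tendsto, Filter.not_le] at h
    obtain ⟨s, hs, hsU⟩ := h
    have hb : Bornology.IsBounded sᶜ := Bornology.isBounded_def.2 (by simpa using hs)
    have hmem : sᶜ ∈ U.map z := by
      rw [Ultrafilter.compl_mem_iff_notMem]
      exact hsU
    obtain ⟨a, -, ha⟩ := hb.isCompact_closure.ultrafilter_le_nhds (U.map z)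
      (le_principal_iff.2 (Filter.mem_of_superset hmem subset_closure))
    exact ⟨a, ha⟩

end WeakConvergence

/-! ### From ultrafilters to subsequences -/

section Extraction

/-- Countably many limits taken along an ultrafilter finer than `atTop` are all realised along one
common subsequence. -/
theorem exists_strictMono_tendsto_of_ultrafilter {κ : Type*} [Countable κ] {Y : κ → Type*}
    (U : Ultrafilter ℕ) (hU : (U : Filter ℕ) ≤ atTop) (f : ∀ k, ℕ → Y k) (l : ∀ k, Filter (Y k))
    [∀ k, (l k).IsCountablyGenerated] (h : ∀ k, Tendsto (f k) U (l k)) :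
    ∃ φ : ℕ → ℕ, StrictMono φ ∧ ∀ k, Tendsto (fun n => f k (φ n)) atTop (l k) := by
  have hle : (U : Filter ℕ) ≤ (⨅ k, comap (f k) (l k)) ⊓ atTop :=
    le_inf (le_iInf fun k => (h k).le_comap) hU
  have : NeBot ((⨅ k, comap (f k) (l k)) ⊓ atTop) := NeBot.mono U.neBot hle
  obtain ⟨ψ, hψ⟩ := exists_seq_tendsto ((⨅ k, comap (f k) (l k)) ⊓ atTop)
  have hψ' := tendsto_inf.1 hψ
  obtain ⟨θ, hθ, hθ'⟩ := strictMono_subseq_of_tendsto_atTop hψ'.2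
  refine ⟨ψ ∘ θ, hθ', fun k => ?_⟩
  have := (tendsto_iInf.1 hψ'.1 k)
  exact (tendsto_comap_iff.1 this).comp hθ.tendsto_atTop

end Extraction

/-! ### Profile decompositions for abstract actions -/

/-- A strongly continuous isometric action `T` of the additive group of a normed space `X` on a
complex inner product space `E` for which `T x u` converges weakly to `0` as `x → ∞`: the abstract
form of translations acting on `H¹(ℝᵈ)`. -/
structure VanishingAction (X E : Type*) [NormedAddCommGroup X] [NormedAddCommGroup E]
    [InnerProductSpace ℂ E] where
  /-- The isometry by which `x` acts. -/
  T : X → E →ₗᵢ[ℂ] E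
  zero_apply : ∀ u, T 0 u = u
  add_apply : ∀ x y u, T (x + y) u = T x (T y u)
  continuous_apply : ∀ u, Continuous fun x => T x u
  tendsto_inner : ∀ f u, Tendsto (fun x => ⟪f, T x u⟫_ℂ) (Bornology.cobounded X) (𝓝 0)

namespace VanishingAction

variable {ι X E F : Type*} [NormedAddCommGroup X] [NormedAddCommGroup E] [InnerProductSpace ℂ E]
  [NormedAddCommGroup F] [InnerProductSpace ℂ F]

section Basic

variable (τ : VanishingAction X E)

theorem apply_neg_apply (x : X) (u : E) : τ.T x (τ.T (-x) u) = u := by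
  rw [← τ.add_apply, add_neg_cancel, τ.zero_apply]

theorem neg_apply_apply (x : X) (u : E) : τ.T (-x) (τ.T x u) = u := by
  rw [← τ.add_apply, neg_add_cancel, τ.zero_apply]

theorem inner_apply_right (x : X) (f u : E) : ⟪f, τ.T x u⟫_ℂ = ⟪τ.T (-x) f, u⟫_ℂ := by
  rw [← (τ.T (-x)).inner_map_map f, neg_apply_apply]

theorem weakTendsto_zero {l : Filter ι} {x : ι → X} (hx : Tendsto x l (Bornology.cobounded X))
    (u : E) : WeakTendsto (fun n => τ.T (x n) u) l 0 := by
  intro f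
  rw [inner_zero_right]
  exact (τ.tendsto_inner f u).comp hx

/-- Convergent translations do not affect weak limits equal to `0`. -/
theorem weakTendsto_zero_of_tendsto {l : Filter ι} {x y : ι → X} {a : X} {w : ι → E} {M : ℝ}
    (hM : ∀ n, ‖w n‖ ≤ M) (hw : WeakTendsto (fun n => τ.T (x n) (w n)) l 0)
    (hxy : Tendsto (fun n => y n - x n) l (𝓝 a)) :
    WeakTendsto (fun n => τ.T (y n) (w n)) l 0 := by
  intro f
  have h1 : Tendsto (fun n => τ.T (-(y n - x n)) f) l (𝓝 (τ.T (-a) f)) :=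
    ((τ.continuous_apply f).tendsto (-a)).comp hxy.neg
  have h2 := hw.inner_of_tendsto (M := M) (fun n => by simpa using hM n) h1
  rw [inner_zero_right] at h2 ⊢
  refine h2.congr fun n => ?_
  rw [← τ.inner_apply_right, ← τ.add_apply, sub_add_cancel]

theorem bddAbove_range_norm_inner (f w : E) :
    BddAbove (Set.range fun y => ‖⟪f, τ.T y w⟫_ℂ‖) := by
  refine ⟨‖f‖ * ‖w‖, ?_⟩
  rintro _ ⟨y, rfl⟩
  simpa using norm_inner_le_norm f (τ.T y w)

theorem norm_inner_le_iSup (f w : E) (y : X) :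
    ‖⟪f, τ.T y w⟫_ℂ‖ ≤ ⨆ x, ‖⟪f, τ.T x w⟫_ℂ‖ :=
  le_ciSup (τ.bddAbove_range_norm_inner f w) y

theorem iSup_norm_inner_le (f w : E) :
    ⨆ y, ‖⟪f, τ.T y w⟫_ℂ‖ ≤ ‖f‖ * ‖w‖ :=
  ciSup_le fun y => by simpa using norm_inner_le_norm f (τ.T y w)

end Basic

/-- A bounded operator `A` *decouples* translates along `l`: it sends a moving profile and a
bounded remainder that vanishes weakly in the frame of the profile to asymptotically orthogonal
vectors. -/
def Decouples (τ : VanishingAction X E) (l : Filter ι) (A : E →L[ℂ] F) : Prop :=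
  ∀ (V : E) (x : ι → X) (w : ι → E) (M : ℝ), (∀ n, ‖w n‖ ≤ M) →
    WeakTendsto (fun n => τ.T (-(x n)) (w n)) l 0 →
    Tendsto (fun n => ⟪A (τ.T (x n) V), A (w n)⟫_ℂ) l (𝓝 0)

/-- An operator intertwining the action with isometries decouples: undoing the translation reduces
the claim to weak convergence of the recentred remainder. -/
theorem decouples_of_commute [CompleteSpace E] [CompleteSpace F] (τ : VanishingAction X E)
    (l : Filter ι) (A : E →L[ℂ] F) (S : X → F →ₗᵢ[ℂ] F) (hS : ∀ x u, A (τ.T x u) = S x (A u)) :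
    τ.Decouples l A := by
  intro V x w M _ hw
  have h := hw.map A (A V)
  rw [map_zero, inner_zero_right] at h
  refine h.congr fun n => ?_
  rw [← (S (x n)).inner_map_map (A V), ← hS, ← hS, τ.apply_neg_apply]

/-- An operator that kills translates going to infinity decouples, even if it does not commute with
translations. -/
theorem decouples_of_tendsto_zero [CompleteSpace E] [CompleteSpace F] [ProperSpace X]
    (τ : VanishingAction X E) (U : Ultrafilter ι) (A : E →L[ℂ] F)
    (hA : ∀ u, Tendsto (fun x => A (τ.T x u)) (Bornology.cobounded X) (𝓝 0)) :
    τ.Decouples (U : Filter ι) A := by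
  intro V x w M hM hw
  have hM' : ∀ n, ‖A (w n)‖ ≤ ‖A‖ * M := fun n =>
    (A.le_opNorm _).trans (mul_le_mul_of_nonneg_left (hM n) (norm_nonneg _))
  rcases ultrafilter_tendsto_cobounded_or_nhds U x with hx | ⟨a, hx⟩
  -- if the frames escape, the profile itself is killed
  · refine squeeze_zero_norm (a := fun n => ‖A (τ.T (x n) V)‖ * (‖A‖ * M)) (fun n => ?_) ?_
    · exact (norm_inner_le_norm _ _).trans (mul_le_mul_of_nonneg_left (hM' n) (norm_nonneg _))
    · simpa using (((hA V).comp hx).norm).mul_const (‖A‖ * M)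
  -- if they converge, the profile converges strongly and the remainder vanishes weakly
  · have h0 : WeakTendsto (fun n => τ.T ((fun _ => (0 : X)) n) (w n)) U 0 := by
      refine τ.weakTendsto_zero_of_tendsto (a := a) hM hw ?_
      simpa using hx
    simp only [τ.zero_apply] at h0
    have h1 : Tendsto (fun n => A (τ.T (x n) V)) U (𝓝 (A (τ.T a V))) :=
      (A.continuous.tendsto _).comp (((τ.continuous_apply V).tendsto a).comp hx)
    simpa using (h0.map A).inner_of_tendsto hM' h1

/-- What remains of `v` after subtracting the first `ℓ` translated profiles. -/
def remainder (τ : VanishingAction X E) (v : ι → E) (x : ℕ → ι → X) (V : ℕ → E) (ℓ : ℕ) (n : ι) :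
    E :=
  v n - ∑ j ∈ Finset.range ℓ, τ.T (x j n) (V j)

section Remainder

variable (τ : VanishingAction X E) {v : ι → E} {x : ℕ → ι → X} {V : ℕ → E}

@[simp]
theorem remainder_zero (n : ι) : τ.remainder v x V 0 n = v n := by
  simp [remainder]

theorem remainder_succ (ℓ : ℕ) (n : ι) :
    τ.remainder v x V (ℓ + 1) n = τ.remainder v x V ℓ n - τ.T (x ℓ n) (V ℓ) := by
  simp [remainder, Finset.sum_range_succ, sub_sub]

theorem norm_remainder_le {M : ℝ} (hM : ∀ n, ‖v n‖ ≤ M) (ℓ : ℕ) (n : ι) :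
    ‖τ.remainder v x V ℓ n‖ ≤ M + ∑ j ∈ Finset.range ℓ, ‖V j‖ := by
  refine (norm_sub_le _ _).trans (add_le_add (hM n) ?_)
  refine (norm_sum_le _ _).trans (Finset.sum_le_sum fun j _ => ?_)
  simp

theorem decoupling_step {l : Filter ι} {A : E →L[ℂ] F} (hA : τ.Decouples l A) {M : ℝ}
    (hM : ∀ n, ‖v n‖ ≤ M)
    (hw : ∀ ℓ, WeakTendsto (fun n => τ.T (-(x ℓ n)) (τ.remainder v x V (ℓ + 1) n)) l 0) (ℓ : ℕ) :
    Tendsto (fun n => ‖A (τ.remainder v x V ℓ n)‖ ^ 2 -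
      (‖A (τ.T (x ℓ n) (V ℓ))‖ ^ 2 + ‖A (τ.remainder v x V (ℓ + 1) n)‖ ^ 2)) l (𝓝 0) := by
  have h := hA (V ℓ) (x ℓ) (τ.remainder v x V (ℓ + 1)) _ (τ.norm_remainder_le hM (ℓ + 1)) (hw ℓ)
  have h2 := ((Complex.continuous_re.tendsto _).comp h).const_mul 2
  rw [Complex.zero_re, mul_zero] at h2
  refine h2.congr fun n => ?_
  have e : τ.remainder v x V ℓ n = τ.T (x ℓ n) (V ℓ) + τ.remainder v x V (ℓ + 1) n := by
    rw [τ.remainder_succ]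
    abel
  rw [e, map_add, @norm_add_sq ℂ]
  simp only [Function.comp_apply]
  change _ = _ + 2 * (⟪A (τ.T (x ℓ n) (V ℓ)), A (τ.remainder v x V (ℓ + 1) n)⟫_ℂ).re + _ - _
  ring

/-- Pythagorean decoupling of the quadratic form `‖A ·‖²` over a profile decomposition. -/
theorem tendsto_decoupling {l : Filter ι} {A : E →L[ℂ] F} (hA : τ.Decouples l A) {M : ℝ}
    (hM : ∀ n, ‖v n‖ ≤ M)
    (hw : ∀ ℓ, WeakTendsto (fun n => τ.T (-(x ℓ n)) (τ.remainder v x V (ℓ + 1) n)) l 0) (ℓ : ℕ) :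
    Tendsto (fun n => ‖A (v n)‖ ^ 2 - ((∑ j ∈ Finset.range ℓ, ‖A (τ.T (x j n) (V j))‖ ^ 2) +
      ‖A (τ.remainder v x V ℓ n)‖ ^ 2)) l (𝓝 0) := by
  induction ℓ with
  | zero => simpa using tendsto_const_nhds
  | succ ℓ ih =>
    have := ih.add (τ.decoupling_step hA hM hw ℓ)
    rw [add_zero] at this
    refine this.congr fun n => ?_
    rw [Finset.sum_range_succ]
    ring

end Remainder

/-- Finitely many sequences leave room for one that diverges from all of them. -/
theorem exists_forall_tendsto_sub_cobounded [NormedSpace ℝ X] [Nontrivial X] {l : Filter ℕ}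
    (hl : l ≤ atTop) (s : List (ℕ → X)) :
    ∃ y : ℕ → X, ∀ z ∈ s, Tendsto (fun n => y n - z n) l (Bornology.cobounded X) := by
  have h : ∀ n : ℕ, ∃ y : X, (n : ℝ) + (s.map fun z => ‖z n‖).sum < ‖y‖ := fun n =>
    NormedSpace.exists_lt_norm ℝ X _
  choose y hy using h
  refine ⟨y, fun z hz => ?_⟩
  rw [← tendsto_norm_atTop_iff_cobounded]
  refine tendsto_atTop_mono (fun n => ?_) (tendsto_natCast_atTop_atTop.mono_left hl)
  have h1 : ‖z n‖ ≤ (s.map fun z => ‖z n‖).sum :=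
    List.single_le_sum (by simp) _ (List.mem_map.2 ⟨z, hz, rfl⟩)
  have h2 := norm_sub_norm_le (y n) (z n)
  linarith [hy n]

section Profiles

variable [NormedSpace ℝ X] [Nontrivial X] [CompleteSpace E]

/-- One step of the extraction: among the weak limits of `w` in frames diverging from the
frames in `s`, one is at least half as large as all the others. -/
theorem exists_almost_maximal_profile (τ : VanishingAction X E) (U : Ultrafilter ℕ)
    (hU : (U : Filter ℕ) ≤ atTop) (w : ℕ → E) (s : List (ℕ → X)) (hw : ∃ M, ∀ n, ‖w n‖ ≤ M) :
    ∃ (y : ℕ → X) (V : E), (∀ z ∈ s, Tendsto (fun n => y n - z n) U (Bornology.cobounded X)) ∧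
      WeakTendsto (fun n => τ.T (-(y n)) (w n)) U V ∧
      ∀ (y' : ℕ → X) (V' : E),
        (∀ z ∈ s, Tendsto (fun n => y' n - z n) U (Bornology.cobounded X)) →
        WeakTendsto (fun n => τ.T (-(y' n)) (w n)) U V' → ‖V'‖ ≤ 2 * ‖V‖ := by
  obtain ⟨M, hM⟩ := hw
  let S : Set ℝ := {r | ∃ (y : ℕ → X) (V : E),
    (∀ z ∈ s, Tendsto (fun n => y n - z n) U (Bornology.cobounded X)) ∧
      WeakTendsto (fun n => τ.T (-(y n)) (w n)) U V ∧ ‖V‖ = r}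
  have hlim : ∀ y : ℕ → X, ∃ V, WeakTendsto (fun n => τ.T (-(y n)) (w n)) U V := fun y =>
    exists_weakTendsto U (M := M) fun n => by simpa using hM n
  have hbdd : BddAbove S := by
    refine ⟨M, ?_⟩
    rintro r ⟨y, V, -, hV, rfl⟩
    exact hV.norm_le fun n => by simpa using hM n
  obtain ⟨y0, hy0⟩ := exists_forall_tendsto_sub_cobounded hU s
  obtain ⟨V0, hV0⟩ := hlim y0
  have hne : S.Nonempty := ⟨_, y0, V0, hy0, hV0, rfl⟩
  have hle : ∀ (y' : ℕ → X) (V' : E),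
      (∀ z ∈ s, Tendsto (fun n => y' n - z n) U (Bornology.cobounded X)) →
      WeakTendsto (fun n => τ.T (-(y' n)) (w n)) U V' → ‖V'‖ ≤ sSup S := fun y' V' h h' =>
    le_csSup hbdd ⟨y', V', h, h', rfl⟩
  -- if all weak limits vanish there is nothing to maximise, and any frame serves
  by_cases h0 : sSup S ≤ 0
  · refine ⟨y0, V0, hy0, hV0, fun y' V' h h' => ?_⟩
    have := hle y' V' h h'
    linarith [norm_nonneg V0]
  · push Not at h0
    obtain ⟨r, ⟨y, V, hy, hV, rfl⟩, hr⟩ := exists_lt_of_lt_csSup hne (half_lt_self h0)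
    refine ⟨y, V, hy, hV, fun y' V' h h' => ?_⟩
    have := hle y' V' h h'
    linarith

/-- Greedy choice of all profiles. The last clause says that the `ℓ`-th profile is almost maximal
among the weak limits of the `ℓ`-th remainder in frames diverging from the earlier ones. -/
theorem exists_profiles (τ : VanishingAction X E) (U : Ultrafilter ℕ)
    (hU : (U : Filter ℕ) ≤ atTop) (v : ℕ → E) {M : ℝ} (hM : ∀ n, ‖v n‖ ≤ M) :
    ∃ (x : ℕ → ℕ → X) (V : ℕ → E),
      (∀ ℓ, ∀ k < ℓ, Tendsto (fun n => x ℓ n - x k n) U (Bornology.cobounded X)) ∧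
      (∀ ℓ, WeakTendsto (fun n => τ.T (-(x ℓ n)) (τ.remainder v x V ℓ n)) U (V ℓ)) ∧
      ∀ (ℓ : ℕ) (y' : ℕ → X) (V' : E),
        (∀ k < ℓ, Tendsto (fun n => y' n - x k n) U (Bornology.cobounded X)) →
        WeakTendsto (fun n => τ.T (-(y' n)) (τ.remainder v x V ℓ n)) U V' →
        ‖V'‖ ≤ 2 * ‖V ℓ‖ := by
  have key := fun st : (ℕ → E) × List (ℕ → X) =>
    τ.exists_almost_maximal_profile U hU st.1 st.2
  choose! y V hyV using key
  -- the state of the recursion: the current remainder and the list of frames used so far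
  let st : ℕ → (ℕ → E) × List (ℕ → X) := fun ℓ =>
    Nat.rec (v, []) (fun _ s => (fun n => s.1 n - τ.T (y s n) (V s), y s :: s.2)) ℓ
  have st_succ : ∀ ℓ, st (ℓ + 1) =
      (fun n => (st ℓ).1 n - τ.T (y (st ℓ) n) (V (st ℓ)), y (st ℓ) :: (st ℓ).2) := fun _ => rfl
  have hst1 : ∀ ℓ, (st ℓ).1 =
      τ.remainder v (fun j => y (st j)) (fun j => V (st j)) ℓ := by
    intro ℓ
    induction ℓ with
    | zero => ext n; simp [st]
    | succ ℓ ih =>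
      ext n
      rw [st_succ, τ.remainder_succ, ← ih]
  have hst2 : ∀ ℓ (z : ℕ → X), z ∈ (st ℓ).2 ↔ ∃ k < ℓ, z = y (st k) := by
    intro ℓ
    induction ℓ with
    | zero => simp [st]
    | succ ℓ ih =>
      intro z
      rw [st_succ, List.mem_cons, ih]
      constructor
      · rintro (rfl | ⟨k, hk, rfl⟩)
        · exact ⟨ℓ, by omega, rfl⟩
        · exact ⟨k, by omega, rfl⟩
      · rintro ⟨k, hk, rfl⟩
        rcases Nat.lt_succ_iff_lt_or_eq.1 hk with h | rfl
        · exact Or.inr ⟨k, h, rfl⟩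
        · exact Or.inl rfl
  have hb : ∀ ℓ, ∃ M', ∀ n, ‖(st ℓ).1 n‖ ≤ M' := fun ℓ => by
    rw [hst1]
    exact ⟨_, τ.norm_remainder_le hM ℓ⟩
  refine ⟨fun j => y (st j), fun j => V (st j), fun ℓ k hk => ?_, fun ℓ => ?_,
    fun ℓ y' V' hy' hV' => ?_⟩
  · exact (hyV (st ℓ) (hb ℓ)).1 _ ((hst2 ℓ _).2 ⟨k, hk, rfl⟩)
  · rw [← hst1]
    exact (hyV (st ℓ) (hb ℓ)).2.1
  · refine (hyV (st ℓ) (hb ℓ)).2.2 y' V' (fun z hz => ?_) ?_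
    · obtain ⟨k, hk, rfl⟩ := (hst2 ℓ z).1 hz
      exact hy' k hk
    · rw [hst1]
      exact hV'

/-- **Abstract profile decomposition** along an ultrafilter. The remainders vanish weakly in the
frame of each extracted profile, their norms have limits bounded by `M`, and they vanish uniformly
over all frames when tested against any fixed vector. -/
theorem exists_profile_decomposition [FiniteDimensional ℝ X] (τ : VanishingAction X E)
    (U : Ultrafilter ℕ) (hU : (U : Filter ℕ) ≤ atTop) (v : ℕ → E) {M : ℝ} (hM : ∀ n, ‖v n‖ ≤ M) :
    ∃ (x : ℕ → ℕ → X) (V : ℕ → E),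
      (∀ j k, k ≠ j → Tendsto (fun n => x k n - x j n) U (Bornology.cobounded X)) ∧
      (∀ ℓ, WeakTendsto (fun n => τ.T (-(x ℓ n)) (τ.remainder v x V (ℓ + 1) n)) U 0) ∧
      (∃ m : ℕ → ℝ, (∀ ℓ, m ℓ ≤ M ^ 2) ∧
        ∀ ℓ, Tendsto (fun n => ‖τ.remainder v x V ℓ n‖ ^ 2) U (𝓝 (m ℓ))) ∧
      ∀ f : E, ∃ b : ℕ → ℝ, Tendsto b atTop (𝓝 0) ∧
        ∀ ℓ, Tendsto (fun n => ⨆ y, ‖⟪f, τ.T y (τ.remainder v x V ℓ n)⟫_ℂ‖) U (𝓝 (b ℓ)) := by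
  obtain ⟨x, V, hx, hV, hmax⟩ := τ.exists_profiles U hU v hM
  have hprop : ProperSpace X := FiniteDimensional.proper_real X
  have hw : ∀ ℓ, WeakTendsto (fun n => τ.T (-(x ℓ n)) (τ.remainder v x V (ℓ + 1) n)) U 0 := by
    intro ℓ
    have h := (hV ℓ).sub (weakTendsto_const (U : Filter ℕ) (V ℓ))
    rw [sub_self] at h
    simpa only [τ.remainder_succ, map_sub, τ.neg_apply_apply] using h
  -- later profiles live in diverging frames, so they do not disturb the earlier frames
  have hw' : ∀ ℓ, ∀ k < ℓ, WeakTendsto (fun n => τ.T (-(x k n)) (τ.remainder v x V ℓ n)) U 0 := by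
    intro ℓ
    induction ℓ with
    | zero => simp
    | succ ℓ ih =>
      intro k hk
      rcases Nat.lt_succ_iff_lt_or_eq.1 hk with h | rfl
      · have h2 := (ih k h).sub (τ.weakTendsto_zero (hx ℓ k h) (V ℓ))
        rw [sub_zero] at h2
        intro f
        refine (h2 f).congr fun n => ?_
        dsimp only
        rw [τ.remainder_succ, map_sub, ← τ.add_apply, neg_add_eq_sub]
      · exact hw k
  have hbd : ∀ ℓ n, ‖τ.remainder v x V ℓ n‖ ≤ M + ∑ j ∈ Finset.range ℓ, ‖V j‖ :=
    τ.norm_remainder_le hM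
  have hreal : ∀ (r : ℕ → ℝ) (C : ℝ), (∀ n, 0 ≤ r n) → (∀ n, r n ≤ C) →
      ∃ b, Tendsto r U (𝓝 b) := by
    intro r C h0 hC
    obtain ⟨b, -, hb⟩ := (isCompact_Icc (a := (0 : ℝ)) (b := C)).ultrafilter_le_nhds (U.map r)
      (le_principal_iff.2 (Filter.mem_map.2 (Filter.univ_mem' fun n => ⟨h0 n, hC n⟩)))
    exact ⟨b, hb⟩
  have hm : ∀ ℓ, ∃ m, Tendsto (fun n => ‖τ.remainder v x V ℓ n‖ ^ 2) U (𝓝 m) := fun ℓ =>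
    hreal _ ((M + ∑ j ∈ Finset.range ℓ, ‖V j‖) ^ 2) (fun n => by positivity)
      fun n => pow_le_pow_left₀ (norm_nonneg _) (hbd ℓ n) 2
  choose m hm using hm
  have hstep : ∀ ℓ, m ℓ = ‖V ℓ‖ ^ 2 + m (ℓ + 1) := by
    intro ℓ
    have hD : τ.Decouples (U : Filter ℕ) (ContinuousLinearMap.id ℂ E) :=
      τ.decouples_of_commute _ _ τ.T fun _ _ => rfl
    have h1 := τ.decoupling_step hD hM hw ℓ
    have h2 := (hm ℓ).sub ((tendsto_const_nhds (x := ‖V ℓ‖ ^ 2)).add (hm (ℓ + 1)))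
    have h3 : m ℓ - (‖V ℓ‖ ^ 2 + m (ℓ + 1)) = 0 := by
      refine tendsto_nhds_unique h2 (h1.congr fun n => ?_)
      simp
    linarith
  have hm0 : ∀ ℓ, 0 ≤ m ℓ := fun ℓ =>
    ge_of_tendsto (hm ℓ) (Eventually.of_forall fun n => by positivity)
  have hmM : ∀ ℓ, m ℓ ≤ M ^ 2 := by
    intro ℓ
    induction ℓ with
    | zero =>
      refine le_of_tendsto (hm 0) (Eventually.of_forall fun n => ?_)
      rw [τ.remainder_zero]
      exact pow_le_pow_left₀ (norm_nonneg _) (hM n) 2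
    | succ ℓ ih => nlinarith [hstep ℓ, sq_nonneg ‖V ℓ‖]
  have hsum : Summable fun ℓ => ‖V ℓ‖ ^ 2 := by
    refine summable_of_sum_range_le (c := m 0) (fun _ => by positivity) fun N => ?_
    have : ∀ N, ∑ i ∈ Finset.range N, ‖V i‖ ^ 2 = m 0 - m N := by
      intro N
      induction N with
      | zero => simp
      | succ N ih => rw [Finset.sum_range_succ, ih]; linarith [hstep N]
    linarith [this N, hm0 N]
  have hV0 : Tendsto (fun ℓ => ‖V ℓ‖) atTop (𝓝 0) := by
    have := (hsum.tendsto_atTop_zero).sqrt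
    simpa [Real.sqrt_sq] using this
  refine ⟨x, V, fun j k hjk => ?_, hw, ⟨m, hmM, hm⟩, fun f => ?_⟩
  · rcases lt_or_gt_of_ne hjk with h | h
    · have := hx j k h
      rw [← tendsto_norm_atTop_iff_cobounded] at this ⊢
      exact this.congr fun n => norm_sub_rev _ _
    · exact hx k j h
  · have hb : ∀ ℓ, ∃ b,
        Tendsto (fun n => ⨆ y, ‖⟪f, τ.T y (τ.remainder v x V ℓ n)⟫_ℂ‖) U (𝓝 b) := fun ℓ =>
      hreal _ (‖f‖ * (M + ∑ j ∈ Finset.range ℓ, ‖V j‖))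
        (fun n => Real.iSup_nonneg fun y => norm_nonneg _)
        fun n => (τ.iSup_norm_inner_le f _).trans
          (mul_le_mul_of_nonneg_left (hbd ℓ n) (norm_nonneg _))
    choose b hb using hb
    refine ⟨b, ?_, hb⟩
    have hb0 : ∀ ℓ, 0 ≤ b ℓ := fun ℓ =>
      ge_of_tendsto (hb ℓ) (Eventually.of_forall fun n => Real.iSup_nonneg fun y => norm_nonneg _)
    have hble : ∀ ℓ, b ℓ ≤ 4 * ‖f‖ * ‖V ℓ‖ := by
      intro ℓ
      -- frames that nearly realise the supremum
      have hy : ∀ n, ∃ y, (⨆ y, ‖⟪f, τ.T y (τ.remainder v x V ℓ n)⟫_ℂ‖) ≤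
          2 * ‖⟪f, τ.T (-y) (τ.remainder v x V ℓ n)⟫_ℂ‖ := by
        intro n
        by_cases h0 : (⨆ y, ‖⟪f, τ.T y (τ.remainder v x V ℓ n)⟫_ℂ‖) ≤ 0
        · exact ⟨0, h0.trans (by positivity)⟩
        · push Not at h0
          obtain ⟨y, hy⟩ := exists_lt_of_lt_ciSup (half_lt_self h0)
          refine ⟨-y, ?_⟩
          rw [neg_neg]
          linarith
      choose y hy using hy
      obtain ⟨V', hV'⟩ := exists_weakTendsto U (w := fun n => τ.T (-(y n))
        (τ.remainder v x V ℓ n)) (M := M + ∑ j ∈ Finset.range ℓ, ‖V j‖)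
        fun n => by simpa using hbd ℓ n
      have h1 : b ℓ ≤ 2 * ‖⟪f, V'⟫_ℂ‖ :=
        le_of_tendsto_of_tendsto (hb ℓ) ((hV' f).norm.const_mul 2) (Eventually.of_forall hy)
      -- frames at bounded distance from an earlier one see a zero limit, all others are covered by
      -- the almost maximality of the profile
      have h2 : ‖V'‖ ≤ 2 * ‖V ℓ‖ := by
        by_cases hd : ∀ k < ℓ, Tendsto (fun n => y n - x k n) U (Bornology.cobounded X)
        · exact hmax ℓ y V' hd hV'
        · push Not at hd
          obtain ⟨k, hk, hnot⟩ := hd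
          obtain ⟨a, ha⟩ :=
            (ultrafilter_tendsto_cobounded_or_nhds U fun n => y n - x k n).resolve_left hnot
          have hz := τ.weakTendsto_zero_of_tendsto (x := fun n => -(x k n))
            (y := fun n => -(y n)) (a := -a) (hbd ℓ) (hw' ℓ k hk)
            (ha.neg.congr fun n => by abel)
          rw [hV'.unique hz, norm_zero]
          positivity
      have h3 := norm_inner_le_norm (𝕜 := ℂ) f V'
      nlinarith [mul_le_mul_of_nonneg_left h2 (norm_nonneg f)]
    refine squeeze_zero hb0 hble ?_
    simpa using hV0.const_mul (4 * ‖f‖)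

end Profiles

end VanishingAction

/-! ### Averages of `Lᵖ` functions -/

section Jensen

variable {X Y : Type*} [MeasurableSpace X] [MeasurableSpace Y]

/-- Jensen's inequality for powers. -/
theorem rpow_lintegral_le_lintegral_rpow {ν : Measure Y} [IsProbabilityMeasure ν] {p : ℝ}
    (hp : 1 ≤ p) {g : Y → ℝ≥0∞} (hg : AEMeasurable g ν) :
    (∫⁻ y, g y ∂ν) ^ p ≤ ∫⁻ y, g y ^ p ∂ν := by
  have hp0 : 0 < p := by linarith
  have h := ENNReal.lintegral_mul_norm_pow_le (μ := ν) (f := fun y => g y ^ p)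
    (g := fun _ => 1) (hg.pow_const p) aemeasurable_const (p := p⁻¹) (q := 1 - p⁻¹)
    (by positivity) (sub_nonneg.2 (inv_le_one_of_one_le₀ hp)) (by ring)
  simp only [ENNReal.one_rpow, mul_one, lintegral_const, measure_univ, ← ENNReal.rpow_mul,
    mul_inv_cancel₀ hp0.ne', ENNReal.rpow_one] at h
  calc (∫⁻ y, g y ∂ν) ^ p ≤ ((∫⁻ y, g y ^ p ∂ν) ^ p⁻¹) ^ p := ENNReal.rpow_le_rpow h hp0.le
    _ = _ := by rw [← ENNReal.rpow_mul, inv_mul_cancel₀ hp0.ne', ENNReal.rpow_one]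

/-- Minkowski's inequality for averages: if `h` is dominated pointwise by an average of the
functions `G · y`, its `Lᵖ` norm is at most the largest of theirs. -/
theorem eLpNorm_le_of_enorm_le_lintegral {μ : Measure X} [SFinite μ] {ν : Measure Y}
    [IsProbabilityMeasure ν] {F F' : Type*} [NormedAddCommGroup F] [NormedAddCommGroup F']
    {p : ℝ≥0∞} (hp : 1 ≤ p) (hp' : p ≠ ⊤) {h : X → F} {G : X → Y → F'}
    (hG : AEStronglyMeasurable (Function.uncurry G) (μ.prod ν))
    (hh : ∀ᵐ x ∂μ, ‖h x‖ₑ ≤ ∫⁻ y, ‖G x y‖ₑ ∂ν) {C : ℝ≥0∞}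
    (hC : ∀ᵐ y ∂ν, eLpNorm (fun x => G x y) p μ ≤ C) :
    eLpNorm h p μ ≤ C := by
  have hpne : p ≠ 0 := (zero_lt_one.trans_le hp).ne'
  have hp1 : 1 ≤ p.toReal := by
    simpa using ENNReal.toReal_mono hp' hp
  have hp0 : 0 < p.toReal := by linarith
  have hGm : ∀ᵐ x ∂μ, AEMeasurable (fun y => ‖G x y‖ₑ) ν := by
    filter_upwards [hG.prodMk_left] with x hx
    exact hx.enorm
  have key : ∫⁻ x, ‖h x‖ₑ ^ p.toReal ∂μ ≤ C ^ p.toReal :=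
    calc ∫⁻ x, ‖h x‖ₑ ^ p.toReal ∂μ ≤ ∫⁻ x, ∫⁻ y, ‖G x y‖ₑ ^ p.toReal ∂ν ∂μ := by
          refine lintegral_mono_ae ?_
          filter_upwards [hh, hGm] with x hx hm
          exact (ENNReal.rpow_le_rpow hx hp0.le).trans (rpow_lintegral_le_lintegral_rpow hp1 hm)
      _ = ∫⁻ y, ∫⁻ x, ‖G x y‖ₑ ^ p.toReal ∂μ ∂ν :=
          lintegral_lintegral_swap (hG.enorm.pow_const _)
      _ ≤ ∫⁻ _, C ^ p.toReal ∂ν := by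
          refine lintegral_mono_ae ?_
          filter_upwards [hC] with y hy
          rw [eLpNorm_eq_lintegral_rpow_enorm_toReal hpne hp'] at hy
          have := ENNReal.rpow_le_rpow hy hp0.le
          rwa [← ENNReal.rpow_mul, one_div, inv_mul_cancel₀ hp0.ne', ENNReal.rpow_one] at this
      _ = _ := by simp
  rw [eLpNorm_eq_lintegral_rpow_enorm_toReal hpne hp']
  refine (ENNReal.rpow_le_rpow key (by positivity)).trans (le_of_eq ?_)
  rw [← ENNReal.rpow_mul, one_div, mul_inv_cancel₀ hp0.ne', ENNReal.rpow_one]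

end Jensen

/-! ### Translation and Hardy estimates for smooth functions -/

section Smooth

variable {d : ℕ}

/-- Poincaré's estimate for translations of smooth functions. -/
theorem eLpNorm_translate_sub_le {f : EuclideanSpace ℝ (Fin d) → ℂ} (hf : ContDiff ℝ ∞ f)
    (t : EuclideanSpace ℝ (Fin d)) :
    eLpNorm (fun x => f (x - t) - f x) 2 volume ≤ ‖t‖ₑ * eLpNorm (fderiv ℝ f) 2 volume := by
  have hd : Differentiable ℝ f := hf.differentiable (by simp)
  have hcf : Continuous (fderiv ℝ f) := hf.continuous_fderiv (by simp)
  let ν : Measure ℝ := volume.restrict (Set.Icc 0 1)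
  have : IsProbabilityMeasure ν := ⟨by simp [ν]⟩
  let G : EuclideanSpace ℝ (Fin d) → ℝ → ℂ := fun x s => fderiv ℝ f (x - s • t) t
  have hGc : Continuous (Function.uncurry G) := by
    have : Function.uncurry G = fun q => fderiv ℝ f (q.1 - q.2 • t) t := rfl
    rw [this]
    fun_prop
  refine eLpNorm_le_of_enorm_le_lintegral (ν := ν) (by norm_num) (by norm_num) (G := G)
    hGc.aestronglyMeasurable (Eventually.of_forall fun x => ?_) (Eventually.of_forall fun s => ?_)
  · have hder : ∀ s ∈ Set.uIcc (0 : ℝ) 1,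
        HasDerivAt (fun s : ℝ => f (x - s • t)) (-(G x s)) s := by
      intro s _
      have h1 : HasDerivAt (fun s : ℝ => x - s • t) (-t) s := by
        simpa using ((hasDerivAt_id s).smul_const t).const_sub x
      have := (hd (x - s • t)).hasFDerivAt.comp_hasDerivAt s h1
      rw [map_neg] at this
      exact this
    have hGx : Continuous fun s => G x s := hGc.comp (by fun_prop : Continuous fun s : ℝ => (x, s))
    have hint := intervalIntegral.integral_eq_sub_of_hasDerivAt hder
      (hGx.neg.intervalIntegrable _ _)
    simp only [one_smul, zero_smul, sub_zero] at hint
    rw [← hint, intervalIntegral.integral_of_le zero_le_one, ← integral_Icc_eq_integral_Ioc]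
    refine (enorm_integral_le_lintegral_enorm _).trans ?_
    simp [ν]
  · have h3 : eLpNorm (fun x => G x s) 2 volume ≤
        ENNReal.ofReal ‖t‖ * eLpNorm (fun x => fderiv ℝ f (x - s • t)) 2 volume := by
      refine eLpNorm_le_mul_eLpNorm_of_ae_le_mul (Eventually.of_forall fun x => ?_) _
      rw [mul_comm]
      exact (fderiv ℝ f (x - s • t)).le_opNorm t
    refine h3.trans (le_of_eq ?_)
    rw [ofReal_norm]
    congr 1
    exact eLpNorm_comp_measurePreserving (g := fderiv ℝ f) hcf.aestronglyMeasurable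
      (measurePreserving_sub_right volume (s • t))

/-- The pointwise inequality behind Hardy's: the divergence of `x / (‖x‖² + ε)` is at least
`r = 1 / (‖x‖² + ε)`, and the cross term is absorbed by Young's inequality. -/
theorem hardy_young_inequality {r s a A I δ : ℝ} (hr : 0 < r) (hrs : r * s ^ 2 ≤ 1)
    (hI : |I| ≤ a * (A * s)) (hδ : 3 ≤ δ) :
    2⁻¹ * (r * a ^ 2) - 2 * A ^ 2 ≤ r * (2 * I) + (δ * r - 2 * s ^ 2 * r ^ 2) * a ^ 2 := by
  have h2 := (abs_le.1 hI).1
  have h4 : r * a ^ 2 ≤ (δ * r - 2 * s ^ 2 * r ^ 2) * a ^ 2 := by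
    refine mul_le_mul_of_nonneg_right ?_ (sq_nonneg a)
    nlinarith
  have h5 : 2 * (r * s * a * A) ≤ 2⁻¹ * (r * a ^ 2) + 2 * A ^ 2 := by
    have h6 : (r * s * a) ^ 2 ≤ r * a ^ 2 := by
      have : (r * s) ^ 2 ≤ r := by nlinarith
      rw [mul_pow]
      exact mul_le_mul_of_nonneg_right this (sq_nonneg a)
    nlinarith [sq_nonneg (r * s * a - 2 * A)]
  nlinarith [mul_le_mul_of_nonneg_left h2 hr.le]

theorem integrable_mul_fderiv_add {F φ : EuclideanSpace ℝ (Fin d) → ℝ} (hF : ContDiff ℝ ∞ F)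
    (hφ : ContDiff ℝ ∞ φ) (hφc : HasCompactSupport φ) (b : EuclideanSpace ℝ (Fin d)) :
    Integrable (fun x => F x * fderiv ℝ φ x b + fderiv ℝ F x b * φ x) ∧
      ∫ x, (F x * fderiv ℝ φ x b + fderiv ℝ F x b * φ x) = 0 := by
  have h1 : Integrable fun x => F x * fderiv ℝ φ x b :=
    (hF.continuous.mul ((hφ.continuous_fderiv (by simp)).clm_apply
      continuous_const)).integrable_of_hasCompactSupport
      (HasCompactSupport.mul_left (hφc.fderiv_apply (𝕜 := ℝ) b))
  have h2 : Integrable fun x => fderiv ℝ F x b * φ x :=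
    (((hF.continuous_fderiv (by simp)).clm_apply continuous_const).mul
      hφ.continuous).integrable_of_hasCompactSupport hφc.mul_left
  have h3 : Integrable fun x => F x * φ x :=
    (hF.continuous.mul hφ.continuous).integrable_of_hasCompactSupport hφc.mul_left
  refine ⟨h1.add h2, ?_⟩
  rw [integral_add h1 h2, integral_mul_fderiv_eq_neg_fderiv_mul_of_integrable h2 h1 h3
    (fun x _ => hF.differentiable (by simp) x) (fun x _ => hφ.differentiable (by simp) x)]
  ring

/-- Hardy's inequality with the weight regularised at the origin, obtained by integrating the
divergence of `|f|² x / (‖x‖² + ε)`. -/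
theorem integral_regularized_hardy_le (hd : 3 ≤ d) {f : EuclideanSpace ℝ (Fin d) → ℂ}
    (hf : ContDiff ℝ ∞ f) (hfc : HasCompactSupport f) {ε : ℝ} (hε : 0 < ε) :
    ∫ x, (‖x‖ ^ 2 + ε)⁻¹ * ‖f x‖ ^ 2 ≤ 4 * ∫ x, ‖fderiv ℝ f x‖ ^ 2 := by
  have hpos : ∀ x : EuclideanSpace ℝ (Fin d), 0 < ‖x‖ ^ 2 + ε := fun x => by positivity
  have hdf : Differentiable ℝ f := hf.differentiable (by simp)
  have hcf : Continuous (fderiv ℝ f) := hf.continuous_fderiv (by simp)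
  let φ : EuclideanSpace ℝ (Fin d) → ℝ := fun x => ‖f x‖ ^ 2
  have hφ : ContDiff ℝ ∞ φ := hf.norm_sq ℝ
  have hφc : HasCompactSupport φ := hfc.comp_left (g := fun z : ℂ => ‖z‖ ^ 2) (by simp)
  have hφ'c : Continuous (fderiv ℝ φ) := hφ.continuous_fderiv (by simp)
  let r : EuclideanSpace ℝ (Fin d) → ℝ := fun x => (‖x‖ ^ 2 + ε)⁻¹
  have hr : ContDiff ℝ ∞ r := ((contDiff_norm_sq ℝ).add contDiff_const).inv fun x => (hpos x).ne'
  have hr' : ∀ x y, fderiv ℝ r x y = -(2 * inner ℝ x y) * r x ^ 2 := by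
    intro x y
    have h1 : HasFDerivAt (fun x : EuclideanSpace ℝ (Fin d) => ‖x‖ ^ 2 + ε)
        ((2 : ℕ) • (innerSL ℝ) x ∘L ContinuousLinearMap.id ℝ _) x :=
      (hasFDerivAt_id x).norm_sq.add_const ε
    have h2 := (hasDerivAt_inv (hpos x).ne').comp_hasFDerivAt x h1
    have h3 : fderiv ℝ r x = _ := h2.fderiv
    rw [h3]
    simp [r]
    ring
  let b := fun i : Fin d => EuclideanSpace.single i (1 : ℝ)
  let F : Fin d → EuclideanSpace ℝ (Fin d) → ℝ := fun i x => x i * r x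
  have hF : ∀ i, ContDiff ℝ ∞ (F i) := fun i =>
    ((EuclideanSpace.proj (𝕜 := ℝ) i : EuclideanSpace ℝ (Fin d) →L[ℝ] ℝ).contDiff).mul hr
  have hFd : ∀ i x, fderiv ℝ (F i) x (b i) = r x + x i * fderiv ℝ r x (b i) := by
    intro i x
    have h1 := (EuclideanSpace.proj (𝕜 := ℝ) i : EuclideanSpace ℝ (Fin d) →L[ℝ] ℝ).hasFDerivAt
      (x := x)
    have h2 := h1.mul (hr.differentiable (by simp) x).hasFDerivAt
    have h3 : fderiv ℝ (F i) x = _ := h2.fderiv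
    rw [h3]
    simp [b]
    ring
  have hsum : ∀ (L : EuclideanSpace ℝ (Fin d) →L[ℝ] ℝ) x, ∑ i, x i * L (b i) = L x := by
    intro L x
    conv_rhs => rw [← (EuclideanSpace.basisFun (Fin d) ℝ).sum_repr x]
    simp [b]
  have hdiv : ∀ x, ∑ i, fderiv ℝ (F i) x (b i) = d * r x - 2 * ‖x‖ ^ 2 * r x ^ 2 := by
    intro x
    simp only [hFd, Finset.sum_add_distrib]
    rw [hsum (fderiv ℝ r x) x, hr' x x, real_inner_self_eq_norm_sq]
    simp
    ring
  have hmain := fun i => integrable_mul_fderiv_add (hF i) hφ hφc (b i)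
  have hzero : ∫ x, (∑ i, (F i x * fderiv ℝ φ x (b i) + fderiv ℝ (F i) x (b i) * φ x)) = 0 := by
    rw [integral_finsetSum Finset.univ fun i _ => (hmain i).1]
    exact Finset.sum_eq_zero fun i _ => (hmain i).2
  have hpt : ∀ x, 2⁻¹ * (r x * φ x) - 2 * ‖fderiv ℝ f x‖ ^ 2 ≤
      ∑ i, (F i x * fderiv ℝ φ x (b i) + fderiv ℝ (F i) x (b i) * φ x) := by
    intro x
    rw [Finset.sum_add_distrib, ← Finset.sum_mul, hdiv]
    have e1 : ∑ i, F i x * fderiv ℝ φ x (b i) = r x * fderiv ℝ φ x x := by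
      rw [← hsum (fderiv ℝ φ x) x, Finset.mul_sum]
      refine Finset.sum_congr rfl fun i _ => ?_
      simp only [F]
      ring
    have e2 : fderiv ℝ φ x x = 2 * inner ℝ (f x) (fderiv ℝ f x x) := by
      have : fderiv ℝ φ x = _ := (hdf x).hasFDerivAt.norm_sq.fderiv
      rw [this]
      simp only [smul_apply, ContinuousLinearMap.comp_apply,
        innerSL_apply_apply, nsmul_eq_mul, Nat.cast_ofNat]
    have h1 : |inner ℝ (f x) (fderiv ℝ f x x)| ≤ ‖f x‖ * (‖fderiv ℝ f x‖ * ‖x‖) :=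
      (abs_real_inner_le_norm _ _).trans
        (mul_le_mul_of_nonneg_left ((fderiv ℝ f x).le_opNorm x) (norm_nonneg _))
    rw [e1, e2]
    exact hardy_young_inequality (inv_pos.2 (hpos x))
      (by rw [mul_comm, ← div_eq_mul_inv, div_le_one (hpos x)]; linarith) h1 (by exact_mod_cast hd)
  have hi1 : Integrable fun x => r x * φ x :=
    (hr.continuous.mul hφ.continuous).integrable_of_hasCompactSupport hφc.mul_left
  have hi2 : Integrable fun x => ‖fderiv ℝ f x‖ ^ 2 := by
    have hc : HasCompactSupport fun x => ‖fderiv ℝ f x‖ ^ 2 :=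
      (hfc.fderiv (𝕜 := ℝ)).comp_left
        (g := fun z : EuclideanSpace ℝ (Fin d) →L[ℝ] ℂ => ‖z‖ ^ 2) (by simp)
    exact (hcf.norm.pow 2).integrable_of_hasCompactSupport hc
  have hfin : ∫ x, (2⁻¹ * (r x * φ x) - 2 * ‖fderiv ℝ f x‖ ^ 2) ≤ 0 := by
    rw [← hzero]
    refine integral_mono ((hi1.const_mul 2⁻¹).sub (hi2.const_mul 2)) ?_ hpt
    exact integrable_finsetSum _ fun i _ => (hmain i).1
  rw [integral_sub (hi1.const_mul 2⁻¹) (hi2.const_mul 2), integral_const_mul,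
    integral_const_mul] at hfin
  have hgoal : ∫ x, r x * φ x ≤ 4 * ∫ x, ‖fderiv ℝ f x‖ ^ 2 := by linarith
  exact hgoal

end Smooth

section SmoothInequalities

variable {d : ℕ}

theorem eLpNorm_two_eq_ofReal_sqrt {X F : Type*} [MeasurableSpace X] [NormedAddCommGroup F]
    {μ : Measure X} {h : X → F} (hh : MemLp h 2 μ) :
    eLpNorm h 2 μ = ENNReal.ofReal (√(∫ x, ‖h x‖ ^ 2 ∂μ)) := by
  rw [hh.eLpNorm_eq_integral_rpow_norm (by norm_num) (by norm_num), Real.sqrt_eq_rpow]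
  simp

/-- Hardy's inequality for test functions, with the constant `2` in place of the sharp
`2 / (d - 2)`. -/
theorem eLpNorm_hardy_le (hd : 3 ≤ d) {f : EuclideanSpace ℝ (Fin d) → ℂ} (hf : ContDiff ℝ ∞ f)
    (hfc : HasCompactSupport f) :
    eLpNorm (fun x => ‖x‖⁻¹ • f x) 2 volume ≤ 2 * eLpNorm (fderiv ℝ f) 2 volume := by
  have hnt : Nontrivial (EuclideanSpace ℝ (Fin d)) :=
    Module.nontrivial_of_finrank_pos (R := ℝ) (by simp; omega)
  let h : ℕ → EuclideanSpace ℝ (Fin d) → ℂ := fun n x =>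
    (√(‖x‖ ^ 2 + 1 / ((n : ℝ) + 1)))⁻¹ • f x
  have hpos : ∀ (n : ℕ) (x : EuclideanSpace ℝ (Fin d)), 0 < ‖x‖ ^ 2 + 1 / ((n : ℝ) + 1) :=
    fun n x => by positivity
  have hc : ∀ n, Continuous (h n) := fun n => by
    have h1 : Continuous fun x : EuclideanSpace ℝ (Fin d) =>
        √(‖x‖ ^ 2 + 1 / ((n : ℝ) + 1)) := by fun_prop
    exact (h1.inv₀ fun x => (Real.sqrt_pos.2 (hpos n x)).ne').smul hf.continuous
  have hm : ∀ n, MemLp (h n) 2 volume := fun n => by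
    have h1 : HasCompactSupport (h n) := hfc.smul_left
      (f := fun x : EuclideanSpace ℝ (Fin d) => (√(‖x‖ ^ 2 + 1 / ((n : ℝ) + 1)))⁻¹)
    exact (hc n).memLp_of_hasCompactSupport h1
  have hm' : MemLp (fderiv ℝ f) 2 volume :=
    (hf.continuous_fderiv (by simp)).memLp_of_hasCompactSupport (hfc.fderiv (𝕜 := ℝ))
  have hbound : ∀ n, eLpNorm (h n) 2 volume ≤ 2 * eLpNorm (fderiv ℝ f) 2 volume := by
    intro n
    have h1 := integral_regularized_hardy_le hd hf hfc (ε := 1 / ((n : ℝ) + 1)) (by positivity)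
    have h2 : ∀ x, ‖h n x‖ ^ 2 = (‖x‖ ^ 2 + 1 / ((n : ℝ) + 1))⁻¹ * ‖f x‖ ^ 2 := by
      intro x
      rw [norm_smul, mul_pow, norm_inv, inv_pow, Real.norm_eq_abs, sq_abs,
        Real.sq_sqrt (hpos n x).le]
    have h3 : ∫ x, ‖h n x‖ ^ 2 ≤ 2 ^ 2 * ∫ x, ‖fderiv ℝ f x‖ ^ 2 := by
      rw [integral_congr_ae (Eventually.of_forall h2)]
      linarith
    have h4 : √(∫ x, ‖h n x‖ ^ 2) ≤ 2 * √(∫ x, ‖fderiv ℝ f x‖ ^ 2) := by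
      have h5 := Real.sqrt_le_sqrt h3
      rwa [Real.sqrt_mul (by norm_num), Real.sqrt_sq (by norm_num)] at h5
    calc eLpNorm (h n) 2 volume = ENNReal.ofReal (√(∫ x, ‖h n x‖ ^ 2)) :=
          eLpNorm_two_eq_ofReal_sqrt (hm n)
      _ ≤ ENNReal.ofReal (2 * √(∫ x, ‖fderiv ℝ f x‖ ^ 2)) := ENNReal.ofReal_le_ofReal h4
      _ = 2 * eLpNorm (fderiv ℝ f) 2 volume := by
          rw [ENNReal.ofReal_mul (by norm_num), eLpNorm_two_eq_ofReal_sqrt hm']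
          simp
  have hlim : ∀ᵐ x ∂(volume : Measure (EuclideanSpace ℝ (Fin d))),
      Tendsto (fun n => h n x) atTop (𝓝 (‖x‖⁻¹ • f x)) := by
    filter_upwards [compl_mem_ae_iff.2 (measure_singleton (0 : EuclideanSpace ℝ (Fin d)))] with x hx
    have hx0 : ‖x‖ ≠ 0 := norm_ne_zero_iff.2 hx
    have h1 := ((tendsto_one_div_add_atTop_nhds_zero_nat (𝕜 := ℝ)).const_add (‖x‖ ^ 2)).sqrt
    rw [add_zero, Real.sqrt_sq (norm_nonneg x)] at h1
    exact (h1.inv₀ hx0).smul_const (f x)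
  refine (Lp.eLpNorm_lim_le_liminf_eLpNorm (fun n => (hc n).aestronglyMeasurable) _ hlim).trans ?_
  exact (liminf_le_liminf (Eventually.of_forall hbound)).trans (by simp)

end SmoothInequalities

/-! ### Mollification -/

section Mollify

variable {d : ℕ} (ρ : ContDiffBump (0 : EuclideanSpace ℝ (Fin d)))

/-- The convolution of `u` with the bump function `ρ`, normalised to have integral one. -/
def mollify (u : EuclideanSpace ℝ (Fin d) → ℂ) : EuclideanSpace ℝ (Fin d) → ℂ :=
  convolution (ρ.normed volume) u (ContinuousLinearMap.lsmul ℝ ℝ) volume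

/-- The probability measure whose density is the normalised bump function `ρ`. -/
def bumpMeasure : Measure (EuclideanSpace ℝ (Fin d)) :=
  volume.withDensity fun t => ENNReal.ofReal (ρ.normed volume t)

theorem lintegral_bumpMeasure (g : EuclideanSpace ℝ (Fin d) → ℝ≥0∞) :
    ∫⁻ t, g t ∂bumpMeasure ρ = ∫⁻ t, ENNReal.ofReal (ρ.normed volume t) * g t := by
  rw [bumpMeasure, lintegral_withDensity_eq_lintegral_mul_non_measurable _
    (by have := ρ.continuous_normed (μ := volume); fun_prop) (by simp)]
  rfl

instance : IsProbabilityMeasure (bumpMeasure ρ) := by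
  constructor
  rw [← lintegral_one, lintegral_bumpMeasure]
  simp only [mul_one]
  rw [← ofReal_integral_eq_lintegral_ofReal ρ.integrable_normed
    (Eventually.of_forall ρ.nonneg_normed), ρ.integral_normed, ENNReal.ofReal_one]

theorem ae_bumpMeasure_norm_le : ∀ᵐ t ∂bumpMeasure ρ, ‖t‖ ≤ ρ.rOut := by
  have hms : MeasurableSet {t : EuclideanSpace ℝ (Fin d) | ¬‖t‖ ≤ ρ.rOut} :=
    (isClosed_le continuous_norm continuous_const).measurableSet.compl
  rw [ae_iff, ← setLIntegral_one, ← lintegral_indicator hms, lintegral_bumpMeasure]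
  refine (lintegral_congr fun t => ?_).trans lintegral_zero
  by_cases ht : ‖t‖ ≤ ρ.rOut
  · simp [ht]
  · have : t ∉ Function.support (ρ.normed volume) := by
      rw [ρ.support_normed_eq]
      simp only [Metric.mem_ball, dist_zero_right]
      linarith
    simp [Function.notMem_support.1 this]

theorem aestronglyMeasurable_sub_bumpMeasure {F : Type*} [NormedAddCommGroup F]
    {u : EuclideanSpace ℝ (Fin d) → F} (hu : AEStronglyMeasurable u volume) :
    AEStronglyMeasurable (Function.uncurry fun x t => u (x - t))
      ((volume : Measure (EuclideanSpace ℝ (Fin d))).prod (bumpMeasure ρ)) := by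
  have h1 := hu.comp_quasiMeasurePreserving
    (quasiMeasurePreserving_sub (volume : Measure (EuclideanSpace ℝ (Fin d))) volume)
  refine h1.mono_ac ?_
  exact Measure.AbsolutelyContinuous.rfl.prod (withDensity_absolutelyContinuous _ _)

variable {u : EuclideanSpace ℝ (Fin d) → ℂ}
  {g : EuclideanSpace ℝ (Fin d) → EuclideanSpace ℂ (Fin d)}

theorem mollify_apply (x : EuclideanSpace ℝ (Fin d)) :
    mollify ρ u x = ∫ t, ρ.normed volume t • u (x - t) := rfl

theorem contDiff_mollify (hu : LocallyIntegrable u volume) : ContDiff ℝ ∞ (mollify ρ u) :=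
  ρ.hasCompactSupport_normed.contDiff_convolution_left _ ρ.contDiff_normed hu

theorem integrable_mollify (hu : LocallyIntegrable u volume) (x : EuclideanSpace ℝ (Fin d)) :
    Integrable fun t => ρ.normed volume t • u (x - t) :=
  ρ.hasCompactSupport_normed.convolutionExists_left (ContinuousLinearMap.lsmul ℝ ℝ)
    ρ.continuous_normed hu x

theorem enorm_integral_bump_smul_le {F : Type*} [NormedAddCommGroup F] [NormedSpace ℝ F]
    (h : EuclideanSpace ℝ (Fin d) → F) :
    ‖∫ t, ρ.normed volume t • h t‖ₑ ≤ ∫⁻ t, ‖h t‖ₑ ∂bumpMeasure ρ := by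
  rw [lintegral_bumpMeasure]
  refine (enorm_integral_le_lintegral_enorm _).trans (lintegral_mono fun t => ?_)
  rw [enorm_smul, Real.enorm_of_nonneg (ρ.nonneg_normed t)]

theorem mollify_sub_apply (hu : LocallyIntegrable u volume) (x : EuclideanSpace ℝ (Fin d)) :
    mollify ρ u x - u x = ∫ t, ρ.normed volume t • (u (x - t) - u x) := by
  simp only [smul_sub]
  rw [integral_sub (integrable_mollify ρ hu x) (ρ.integrable_normed.smul_const _),
    ρ.integral_normed_smul (μ := volume), mollify_apply]

theorem eLpNorm_mollify_le {p : ℝ≥0∞} (hp : 1 ≤ p) (hp' : p ≠ ⊤)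
    (hu : AEStronglyMeasurable u volume) :
    eLpNorm (mollify ρ u) p volume ≤ eLpNorm u p volume := by
  refine eLpNorm_le_of_enorm_le_lintegral (ν := bumpMeasure ρ) hp hp'
    (aestronglyMeasurable_sub_bumpMeasure ρ hu)
    (Eventually.of_forall fun x => enorm_integral_bump_smul_le ρ _)
    (Eventually.of_forall fun t => le_of_eq ?_)
  exact eLpNorm_comp_measurePreserving hu (measurePreserving_sub_right volume t)

theorem eLpNorm_mollify_sub_le {p : ℝ≥0∞} (hp : 1 ≤ p) (hp' : p ≠ ⊤)
    (hu : LocallyIntegrable u volume) {C : ℝ≥0∞}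
    (hC : ∀ t, ‖t‖ ≤ ρ.rOut → eLpNorm (fun x => u (x - t) - u x) p volume ≤ C) :
    eLpNorm (fun x => mollify ρ u x - u x) p volume ≤ C := by
  refine eLpNorm_le_of_enorm_le_lintegral (ν := bumpMeasure ρ) hp hp'
    (G := fun x t => u (x - t) - u x) ?_
    (Eventually.of_forall fun x => ?_) ?_
  · exact (aestronglyMeasurable_sub_bumpMeasure ρ hu.aestronglyMeasurable).sub
      hu.aestronglyMeasurable.comp_fst
  · rw [mollify_sub_apply ρ hu]
    exact enorm_integral_bump_smul_le ρ _
  · filter_upwards [ae_bumpMeasure_norm_le ρ] with t ht using hC t ht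

end Mollify

/-! ### Weak gradients and mollification -/

section WeakGradient

variable {d : ℕ} {u : EuclideanSpace ℝ (Fin d) → ℂ}
  {g : EuclideanSpace ℝ (Fin d) → EuclideanSpace ℂ (Fin d)}

theorem LocallyIntegrable.euclidean_apply (hg : LocallyIntegrable g volume) (i : Fin d) :
    LocallyIntegrable (fun x => g x i) volume := by
  intro x
  obtain ⟨s, hs, hgs⟩ := hg x
  exact ⟨s, hs, (EuclideanSpace.proj i : EuclideanSpace ℂ (Fin d) →L[ℂ] ℂ).integrable_comp hgs⟩

theorem norm_sum_smul_le (v : EuclideanSpace ℝ (Fin d)) (z : EuclideanSpace ℂ (Fin d)) :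
    ‖∑ i, v i • z i‖ ≤ ‖v‖ * ‖z‖ := by
  refine (norm_sum_le _ _).trans ?_
  simp only [norm_smul]
  rw [EuclideanSpace.norm_eq, EuclideanSpace.norm_eq]
  exact Real.sum_mul_le_sqrt_mul_sqrt _ _ _

theorem HasWeakGradient.integral_fderiv_smul (h : HasWeakGradient u g)
    {ψ : EuclideanSpace ℝ (Fin d) → ℝ} (hψ : ContDiff ℝ ∞ ψ) (hψc : HasCompactSupport ψ)
    (v : EuclideanSpace ℝ (Fin d)) :
    ∫ x, (fderiv ℝ ψ x v) • u x = -∫ x, ψ x • ∑ i, v i • g x i := by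
  have hsum : ∀ x, fderiv ℝ ψ x v =
      ∑ i, v i * fderiv ℝ ψ x (EuclideanSpace.single i 1) := by
    intro x
    conv_lhs => rw [← (EuclideanSpace.basisFun (Fin d) ℝ).sum_repr v]
    simp
  have h1 : ∀ i : Fin d,
      Integrable fun x => (v i * fderiv ℝ ψ x (EuclideanSpace.single i 1)) • u x := by
    intro i
    refine h.1.integrable_smul_left_of_hasCompactSupport ?_ ?_
    · exact continuous_const.mul ((hψ.continuous_fderiv (by simp)).clm_apply continuous_const)
    · exact HasCompactSupport.mul_left (hψc.fderiv_apply (𝕜 := ℝ) _)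
  have h2 : ∀ i : Fin d, Integrable fun x => v i • (ψ x • g x i) := fun i =>
    ((LocallyIntegrable.euclidean_apply h.2.1 i).integrable_smul_left_of_hasCompactSupport
      hψ.continuous hψc).smul (v i)
  have e1 : ∀ x, (fderiv ℝ ψ x v) • u x =
      ∑ i, (v i * fderiv ℝ ψ x (EuclideanSpace.single i 1)) • u x := fun x => by
    rw [hsum, Finset.sum_smul]
  have e2 : ∀ x, ψ x • ∑ i, v i • g x i = ∑ i, v i • (ψ x • g x i) := fun x => by
    rw [Finset.smul_sum]
    exact Finset.sum_congr rfl fun i _ => smul_comm _ _ _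
  simp only [e1, e2]
  rw [integral_finsetSum _ fun i _ => h1 i, integral_finsetSum _ fun i _ => h2 i,
    ← Finset.sum_neg_distrib]
  refine Finset.sum_congr rfl fun i _ => ?_
  simp only [mul_smul, integral_smul]
  rw [h.2.2 ψ hψ hψc i, smul_neg]

/-- Mollification commutes with the weak gradient. -/
theorem HasWeakGradient.fderiv_mollify (h : HasWeakGradient u g)
    (ρ : ContDiffBump (0 : EuclideanSpace ℝ (Fin d))) (x v : EuclideanSpace ℝ (Fin d)) :
    fderiv ℝ (mollify ρ u) x v = ∫ t, ρ.normed volume t • ∑ i, v i • g (x - t) i := by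
  have hρ : ContDiff ℝ ∞ (ρ.normed (volume : Measure (EuclideanSpace ℝ (Fin d)))) :=
    ρ.contDiff_normed
  have hρc := ρ.hasCompactSupport_normed (μ := (volume : Measure (EuclideanSpace ℝ (Fin d))))
  let L : ℝ →L[ℝ] ℂ →L[ℝ] ℂ := ContinuousLinearMap.lsmul ℝ ℝ
  have h1 : fderiv ℝ (mollify ρ u) x = _ :=
    (hρc.hasFDerivAt_convolution_left L (hρ.of_le (by simp)) h.1 x).fderiv
  have hint := (hρc.fderiv (𝕜 := ℝ)).convolutionExists_left
    (L.precompL (EuclideanSpace ℝ (Fin d))) (hρ.continuous_fderiv (by simp)) h.1 x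
  have h2 : fderiv ℝ (mollify ρ u) x v =
      ∫ t, (fderiv ℝ (ρ.normed volume) t v) • u (x - t) := by
    rw [h1, convolution, ContinuousLinearMap.integral_apply hint]
    rfl
  rw [h2]
  let ψ : EuclideanSpace ℝ (Fin d) → ℝ := fun s => ρ.normed volume (x - s)
  have hψ : ContDiff ℝ ∞ ψ := hρ.comp (contDiff_const.sub contDiff_id)
  have hψc : HasCompactSupport ψ := hρc.comp_homeomorph (Homeomorph.subLeft x)
  have hψ' : ∀ s, fderiv ℝ ψ s v = -fderiv ℝ (ρ.normed volume) (x - s) v := by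
    intro s
    have h3 : HasFDerivAt ψ _ s := (hρ.differentiable (by simp) (x - s)).hasFDerivAt.comp s
      ((hasFDerivAt_id s).const_sub x)
    rw [h3.fderiv]
    simp
  have h4 := h.integral_fderiv_smul hψ hψc v
  simp only [hψ', neg_smul, integral_neg, neg_inj] at h4
  rw [← integral_sub_left_eq_self _ volume x]
  simp only [sub_sub_cancel]
  rw [h4, ← integral_sub_left_eq_self _ volume x]
  simp only [ψ, sub_sub_cancel]

theorem HasWeakGradient.enorm_fderiv_mollify_le (h : HasWeakGradient u g)
    (ρ : ContDiffBump (0 : EuclideanSpace ℝ (Fin d))) (x : EuclideanSpace ℝ (Fin d)) :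
    ‖fderiv ℝ (mollify ρ u) x‖ₑ ≤ ∫⁻ t, ‖g (x - t)‖ₑ ∂bumpMeasure ρ := by
  have hint : Integrable fun t => ρ.normed volume t * ‖g (x - t)‖ := by
    have h0 := (ρ.hasCompactSupport_normed
      (μ := (volume : Measure (EuclideanSpace ℝ (Fin d))))).convolutionExists_left
      (ContinuousLinearMap.lsmul ℝ ℝ) ρ.continuous_normed h.2.1 x
    have h1 := Integrable.norm h0
    refine h1.congr (Eventually.of_forall fun t => ?_)
    simp [norm_smul, abs_of_nonneg (ρ.nonneg_normed t)]
  have hnn : ∀ t, 0 ≤ ρ.normed volume t * ‖g (x - t)‖ := fun t =>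
    mul_nonneg (ρ.nonneg_normed t) (norm_nonneg _)
  have hle : ‖fderiv ℝ (mollify ρ u) x‖ ≤ ∫ t, ρ.normed volume t * ‖g (x - t)‖ := by
    refine ContinuousLinearMap.opNorm_le_bound _ (integral_nonneg hnn) fun v => ?_
    rw [h.fderiv_mollify, ← integral_mul_const]
    refine norm_integral_le_of_norm_le (hint.mul_const _) (Eventually.of_forall fun t => ?_)
    rw [norm_smul, Real.norm_of_nonneg (ρ.nonneg_normed t), mul_assoc]
    refine mul_le_mul_of_nonneg_left ?_ (ρ.nonneg_normed t)
    rw [mul_comm]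
    exact norm_sum_smul_le _ _
  rw [← ofReal_norm, lintegral_bumpMeasure]
  refine (ENNReal.ofReal_le_ofReal hle).trans (le_of_eq ?_)
  rw [ofReal_integral_eq_lintegral_ofReal hint (Eventually.of_forall hnn)]
  refine lintegral_congr fun t => ?_
  rw [ENNReal.ofReal_mul (ρ.nonneg_normed t), ofReal_norm]

theorem HasWeakGradient.eLpNorm_fderiv_mollify_le (h : HasWeakGradient u g)
    (ρ : ContDiffBump (0 : EuclideanSpace ℝ (Fin d))) :
    eLpNorm (fderiv ℝ (mollify ρ u)) 2 volume ≤ eLpNorm g 2 volume := by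
  have hg := h.2.1.aestronglyMeasurable
  refine eLpNorm_le_of_enorm_le_lintegral (ν := bumpMeasure ρ) (by norm_num) (by norm_num)
    (aestronglyMeasurable_sub_bumpMeasure ρ hg)
    (Eventually.of_forall fun x => h.enorm_fderiv_mollify_le ρ x)
    (Eventually.of_forall fun t => le_of_eq ?_)
  exact eLpNorm_comp_measurePreserving hg (measurePreserving_sub_right volume t)

end WeakGradient

/-! ### Inequalities for functions with a weak gradient -/

section Approximation

variable {d : ℕ}

/-- A smooth cutoff equal to `1` on the ball of radius `k + 1`, with gradient of size
`O(1 / (k + 1))`. -/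
theorem exists_cutoff (d : ℕ) : ∃ (χ : ℕ → EuclideanSpace ℝ (Fin d) → ℝ) (C : ℝ), 0 ≤ C ∧
    ∀ k, ContDiff ℝ ∞ (χ k) ∧ HasCompactSupport (χ k) ∧ (∀ x, |χ k x| ≤ 1) ∧
      (∀ x, ‖x‖ ≤ k + 1 → χ k x = 1) ∧ ∀ x, ‖fderiv ℝ (χ k) x‖ ≤ C / (k + 1) := by
  let b : ContDiffBump (0 : EuclideanSpace ℝ (Fin d)) := ⟨1, 2, by norm_num, by norm_num⟩
  have hb : ContDiff ℝ ∞ b := b.contDiff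
  obtain ⟨C, hC⟩ := (b.hasCompactSupport.fderiv (𝕜 := ℝ)).exists_bound_of_continuous
    (hb.continuous_fderiv (by simp))
  have hC0 : 0 ≤ C := (norm_nonneg _).trans (hC 0)
  have hk : ∀ k : ℕ, (0 : ℝ) < (k : ℝ) + 1 := fun k => by positivity
  refine ⟨fun k x => b (((k : ℝ) + 1)⁻¹ • x), C, hC0, fun k => ⟨?_, ?_, fun x => ?_,
    fun x hx => ?_, fun x => ?_⟩⟩
  · exact hb.comp (contDiff_const_smul _)
  · exact b.hasCompactSupport.comp_smul (inv_ne_zero (hk k).ne')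
  · rw [abs_of_nonneg b.nonneg]
    exact b.le_one
  · refine b.one_of_mem_closedBall ?_
    rw [mem_closedBall_zero_iff, norm_smul, norm_inv, Real.norm_of_nonneg (hk k).le,
      inv_mul_le_iff₀ (hk k)]
    simpa [b] using hx
  · have h1 : HasFDerivAt (fun x => b (((k : ℝ) + 1)⁻¹ • x)) _ x :=
      (hb.differentiable (by simp) (((k : ℝ) + 1)⁻¹ • x)).hasFDerivAt.comp x
        ((hasFDerivAt_id x).const_smul ((k : ℝ) + 1)⁻¹)
    rw [h1.fderiv, ContinuousLinearMap.comp_smul, norm_smul, norm_inv,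
      Real.norm_of_nonneg (hk k).le, div_eq_inv_mul]
    exact mul_le_mul_of_nonneg_left (hC _) (by positivity)

/-- Approximation of a function with weak gradient by test functions, in the weak form needed to
pass to the limit with Fatou's lemma. -/
theorem HasWeakGradient.exists_approx {u : EuclideanSpace ℝ (Fin d) → ℂ}
    {g : EuclideanSpace ℝ (Fin d) → EuclideanSpace ℂ (Fin d)} (h : HasWeakGradient u g) :
    ∃ (f : ℕ → EuclideanSpace ℝ (Fin d) → ℂ) (C : ℝ),
      (∀ k, ContDiff ℝ ∞ (f k)) ∧ (∀ k, HasCompactSupport (f k)) ∧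
      (∀ᵐ x, Tendsto (fun k => f k x) atTop (𝓝 (u x))) ∧
      ∀ k : ℕ, eLpNorm (fderiv ℝ (f k)) 2 volume ≤
        eLpNorm g 2 volume + ENNReal.ofReal (C / ((k : ℝ) + 1)) * eLpNorm u 2 volume := by
  obtain ⟨χ, C, hC0, hχ⟩ := exists_cutoff d
  let ρ : ℕ → ContDiffBump (0 : EuclideanSpace ℝ (Fin d)) := fun k =>
    ⟨1 / ((k : ℝ) + 1) / 2, 1 / ((k : ℝ) + 1), by positivity, half_lt_self (by positivity)⟩
  have hm : ∀ k, ContDiff ℝ ∞ (mollify (ρ k) u) := fun k => contDiff_mollify _ h.1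
  refine ⟨fun k x => χ k x • mollify (ρ k) u x, C, fun k => (hχ k).1.smul (hm k),
    fun k => (hχ k).2.1.smul_right, ?_, fun k => ?_⟩
  · have hlim := ContDiffBump.ae_convolution_tendsto_right_of_locallyIntegrable
      (μ := (volume : Measure (EuclideanSpace ℝ (Fin d)))) (φ := ρ) (l := atTop) (K := 2)
      (tendsto_one_div_add_atTop_nhds_zero_nat (𝕜 := ℝ))
      (Eventually.of_forall fun k => by simp only [ρ]; linarith) h.1
    filter_upwards [hlim] with x hx
    refine hx.congr' ?_
    filter_upwards [tendsto_natCast_atTop_atTop.eventually_ge_atTop ‖x‖] with k hk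
    rw [(hχ k).2.2.2.1 x (by linarith), one_smul]
    rfl
  · have hk : (0 : ℝ) < (k : ℝ) + 1 := by positivity
    have hpt : ∀ x, ‖fderiv ℝ (fun x => χ k x • mollify (ρ k) u x) x‖ ≤
        ‖fderiv ℝ (mollify (ρ k) u) x‖ + C / (k + 1) * ‖mollify (ρ k) u x‖ := by
      intro x
      have h1 := ((hχ k).1.differentiable (by simp) x).hasFDerivAt.smul
        ((hm k).differentiable (by simp) x).hasFDerivAt
      have h2 : fderiv ℝ (fun x => χ k x • mollify (ρ k) u x) x = _ := h1.fderiv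
      rw [h2]
      refine (norm_add_le _ _).trans (add_le_add ?_ ?_)
      · rw [norm_smul, Real.norm_eq_abs]
        exact mul_le_of_le_one_left (norm_nonneg _) ((hχ k).2.2.1 x)
      · rw [ContinuousLinearMap.norm_smulRight_apply]
        exact mul_le_mul_of_nonneg_right ((hχ k).2.2.2.2 x) (norm_nonneg _)
    refine (eLpNorm_mono_real (g := fun x => ‖fderiv ℝ (mollify (ρ k) u) x‖ +
      C / (k + 1) * ‖mollify (ρ k) u x‖) hpt).trans ?_
    have hc1 : Continuous (fderiv ℝ (mollify (ρ k) u)) := (hm k).continuous_fderiv (by simp)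
    refine (eLpNorm_add_le hc1.norm.aestronglyMeasurable
      (continuous_const.mul (hm k).continuous.norm).aestronglyMeasurable (by norm_num)).trans ?_
    refine add_le_add ?_ ?_
    · rw [eLpNorm_norm]
      exact h.eLpNorm_fderiv_mollify_le _
    · have h2 := eLpNorm_const_smul (C / ((k : ℝ) + 1)) (fun x => ‖mollify (ρ k) u x‖) 2
        (volume : Measure (EuclideanSpace ℝ (Fin d)))
      change eLpNorm ((C / ((k : ℝ) + 1)) • fun x => ‖mollify (ρ k) u x‖) 2 volume ≤ _
      rw [h2, eLpNorm_norm, Real.enorm_of_nonneg (by positivity)]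
      gcongr
      exact eLpNorm_mollify_le _ (by norm_num) (by norm_num) h.1.aestronglyMeasurable

/-- An estimate by the gradient that holds for test functions and is stable under pointwise
convergence holds for every `L²` function with a weak gradient in `L²`. -/
theorem HasWeakGradient.eLpNorm_le_of_forall_smooth {u : EuclideanSpace ℝ (Fin d) → ℂ}
    {g : EuclideanSpace ℝ (Fin d) → EuclideanSpace ℂ (Fin d)} (h : HasWeakGradient u g)
    (hu : MemLp u 2 volume) {Φ : (EuclideanSpace ℝ (Fin d) → ℂ) → EuclideanSpace ℝ (Fin d) → ℂ}
    {p C : ℝ≥0∞} (hC : C ≠ ⊤)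
    (hΦ : ∀ f : EuclideanSpace ℝ (Fin d) → ℂ, ContDiff ℝ ∞ f → HasCompactSupport f →
      AEStronglyMeasurable (Φ f) volume ∧ eLpNorm (Φ f) p volume ≤
        C * eLpNorm (fderiv ℝ f) 2 volume)
    (hlim : ∀ f : ℕ → EuclideanSpace ℝ (Fin d) → ℂ,
      (∀ᵐ x, Tendsto (fun k => f k x) atTop (𝓝 (u x))) →
      ∀ᵐ x, Tendsto (fun k => Φ (f k) x) atTop (𝓝 (Φ u x))) :
    eLpNorm (Φ u) p volume ≤ C * eLpNorm g 2 volume := by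
  obtain ⟨f, K, hf, hfc, hfu, hfg⟩ := h.exists_approx
  refine (Lp.eLpNorm_lim_le_liminf_eLpNorm (fun k => (hΦ (f k) (hf k) (hfc k)).1) _
    (hlim f hfu)).trans ?_
  have hb : ∀ k, eLpNorm (Φ (f k)) p volume ≤ C * (eLpNorm g 2 volume +
      ENNReal.ofReal (K / ((k : ℝ) + 1)) * eLpNorm u 2 volume) := fun k =>
    (hΦ (f k) (hf k) (hfc k)).2.trans (mul_le_mul_right (hfg k) _)
  refine (liminf_le_liminf (Eventually.of_forall hb)).trans (le_of_eq ?_)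
  refine Tendsto.liminf_eq ?_
  refine ENNReal.Tendsto.const_mul ?_ (Or.inr hC)
  have h1 : Tendsto (fun k : ℕ => ENNReal.ofReal (K / ((k : ℝ) + 1)) * eLpNorm u 2 volume) atTop
      (𝓝 (0 * eLpNorm u 2 volume)) := by
    refine ENNReal.Tendsto.mul_const ?_ (Or.inr hu.2.ne)
    rw [← ENNReal.ofReal_zero]
    refine ENNReal.tendsto_ofReal ?_
    simpa [div_eq_mul_inv] using (tendsto_one_div_add_atTop_nhds_zero_nat (𝕜 := ℝ)).const_mul K
  simpa using h1.const_add (eLpNorm g 2 volume)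

variable {u : EuclideanSpace ℝ (Fin d) → ℂ}
  {g : EuclideanSpace ℝ (Fin d) → EuclideanSpace ℂ (Fin d)}

theorem HasWeakGradient.eLpNorm_hardy_le (h : HasWeakGradient u g) (hd : 3 ≤ d)
    (hu : MemLp u 2 volume) :
    eLpNorm (fun x => ‖x‖⁻¹ • u x) 2 volume ≤ 2 * eLpNorm g 2 volume :=
  h.eLpNorm_le_of_forall_smooth hu (Φ := fun f x => ‖x‖⁻¹ • f x) (by norm_num)
    (fun _ hf hfc => ⟨(measurable_norm.inv.smul hf.continuous.measurable).aestronglyMeasurable,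
      _root_.eLpNorm_hardy_le hd hf hfc⟩)
    fun _ hf => by filter_upwards [hf] with x hx using hx.const_smul _

theorem HasWeakGradient.eLpNorm_translate_sub_le (h : HasWeakGradient u g)
    (hu : MemLp u 2 volume) (t : EuclideanSpace ℝ (Fin d)) :
    eLpNorm (fun x => u (x - t) - u x) 2 volume ≤ ‖t‖ₑ * eLpNorm g 2 volume :=
  h.eLpNorm_le_of_forall_smooth hu (Φ := fun f x => f (x - t) - f x) (by simp)
    (fun f hf _ => ⟨((hf.continuous.comp (continuous_sub_right t)).sub
      hf.continuous).aestronglyMeasurable, _root_.eLpNorm_translate_sub_le hf t⟩)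
    fun f hf => by
      have h1 := (measurePreserving_sub_right (volume : Measure (EuclideanSpace ℝ (Fin d)))
        t).quasiMeasurePreserving.ae hf
      filter_upwards [hf, h1] with x hx hx' using hx'.sub hx

/-- The Gagliardo–Nirenberg–Sobolev inequality for the exponent `2d / (d - 2)`. -/
theorem exists_eLpNorm_sobolev_le (hd : 3 ≤ d) : ∃ C : ℝ≥0∞, C ≠ ⊤ ∧
    ∀ (u : EuclideanSpace ℝ (Fin d) → ℂ)
      (g : EuclideanSpace ℝ (Fin d) → EuclideanSpace ℂ (Fin d)), HasWeakGradient u g →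
      MemLp u 2 volume →
      eLpNorm u (ENNReal.ofReal (2 * (d : ℝ) / ((d : ℝ) - 2))) volume ≤
        C * eLpNorm g 2 volume := by
  have hd3 : (3 : ℝ) ≤ d := by exact_mod_cast hd
  have hq : 0 ≤ 2 * (d : ℝ) / ((d : ℝ) - 2) := div_nonneg (by positivity) (by linarith)
  let q : NNReal := ⟨2 * (d : ℝ) / ((d : ℝ) - 2), hq⟩
  have hqe : ENNReal.ofReal (2 * (d : ℝ) / ((d : ℝ) - 2)) = (q : ℝ≥0∞) := by
    rw [ENNReal.ofReal_eq_coe_nnreal hq]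
    rfl
  refine ⟨(SNormLESNormFDerivOfEqConst ℂ
    (volume : Measure (EuclideanSpace ℝ (Fin d))) ((2 : NNReal) : ℝ) : NNReal),
    ENNReal.coe_ne_top, fun u g h hu => ?_⟩
  rw [hqe]
  refine h.eLpNorm_le_of_forall_smooth hu (Φ := fun f => f) ENNReal.coe_ne_top
    (fun f hf hfc => ⟨hf.continuous.aestronglyMeasurable, ?_⟩) fun _ hf => hf
  have := eLpNorm_le_eLpNorm_fderiv_of_eq (volume : Measure (EuclideanSpace ℝ (Fin d)))
    (hf.of_le (by simp)) hfc (p := 2) (p' := q) (by norm_num) (by simp; omega) (by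
      simp only [finrank_euclideanSpace, Fintype.card_fin]
      change (2 * (d : ℝ) / ((d : ℝ) - 2))⁻¹ = ((2 : NNReal) : ℝ)⁻¹ - (d : ℝ)⁻¹
      have : (d : ℝ) - 2 ≠ 0 := by linarith
      push_cast
      field_simp)
  simpa using this

end Approximation

/-! ### Calculus of weak gradients -/

section WeakGradientCalculus

variable {d : ℕ} {u v : EuclideanSpace ℝ (Fin d) → ℂ}
  {g h : EuclideanSpace ℝ (Fin d) → EuclideanSpace ℂ (Fin d)}

theorem integrable_fderiv_smul {ψ : EuclideanSpace ℝ (Fin d) → ℝ} (hu : LocallyIntegrable u volume)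
    (hψ : ContDiff ℝ ∞ ψ) (hψc : HasCompactSupport ψ) (e : EuclideanSpace ℝ (Fin d)) :
    Integrable fun x => (fderiv ℝ ψ x e) • u x :=
  hu.integrable_smul_left_of_hasCompactSupport
    ((hψ.continuous_fderiv (by simp)).clm_apply continuous_const)
    (hψc.fderiv_apply (𝕜 := ℝ) _)

theorem integrable_smul_apply {ψ : EuclideanSpace ℝ (Fin d) → ℝ} (hg : LocallyIntegrable g volume)
    (hψ : ContDiff ℝ ∞ ψ) (hψc : HasCompactSupport ψ) (i : Fin d) :
    Integrable fun x => ψ x • g x i :=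
  (LocallyIntegrable.euclidean_apply hg i).integrable_smul_left_of_hasCompactSupport
    hψ.continuous hψc

theorem HasWeakGradient.add (hu : HasWeakGradient u g) (hv : HasWeakGradient v h) :
    HasWeakGradient (fun x => u x + v x) (fun x => g x + h x) := by
  refine ⟨hu.1.add hv.1, hu.2.1.add hv.2.1, fun ψ hψ hψc i => ?_⟩
  simp only [smul_add, PiLp.add_apply]
  rw [integral_add (integrable_fderiv_smul hu.1 hψ hψc _) (integrable_fderiv_smul hv.1 hψ hψc _),
    integral_add (integrable_smul_apply hu.2.1 hψ hψc i) (integrable_smul_apply hv.2.1 hψ hψc i),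
    hu.2.2 ψ hψ hψc i, hv.2.2 ψ hψ hψc i]
  ring

theorem HasWeakGradient.const_smul (hu : HasWeakGradient u g) (c : ℂ) :
    HasWeakGradient (fun x => c • u x) (fun x => c • g x) := by
  refine ⟨hu.1.smul c, hu.2.1.smul c, fun ψ hψ hψc i => ?_⟩
  have e1 : ∀ x, (fderiv ℝ ψ x (EuclideanSpace.single i 1)) • c • u x =
      c • (fderiv ℝ ψ x (EuclideanSpace.single i 1)) • u x := fun x => smul_comm _ _ _
  have e2 : ∀ x, ψ x • (c • g x) i = c • (ψ x • g x i) := fun x => by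
    rw [PiLp.smul_apply, smul_comm]
  simp only [e1, e2, integral_smul]
  rw [hu.2.2 ψ hψ hψc i, smul_neg]

theorem HasWeakGradient.zero : HasWeakGradient (fun _ : EuclideanSpace ℝ (Fin d) => (0 : ℂ))
    (fun _ => 0) :=
  ⟨locallyIntegrable_zero, locallyIntegrable_zero, fun ψ _ _ i => by simp⟩

theorem HasWeakGradient.congr_ae (hu : HasWeakGradient u g) (huv : u =ᵐ[volume] v)
    (hgh : g =ᵐ[volume] h) : HasWeakGradient v h := by
  refine ⟨hu.1.congr huv, hu.2.1.congr hgh, fun ψ hψ hψc i => ?_⟩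
  have h1 : ∫ x, (fderiv ℝ ψ x (EuclideanSpace.single i 1)) • u x =
      ∫ x, (fderiv ℝ ψ x (EuclideanSpace.single i 1)) • v x :=
    integral_congr_ae (huv.mono fun x hx => by simp only [hx])
  have h2 : ∫ x, ψ x • g x i = ∫ x, ψ x • h x i :=
    integral_congr_ae (hgh.mono fun x hx => by simp only [hx])
  rw [← h1, ← h2]
  exact hu.2.2 ψ hψ hψc i

theorem locallyIntegrable_comp_sub_right {F : Type*} [NormedAddCommGroup F]
    {w : EuclideanSpace ℝ (Fin d) → F} (hw : LocallyIntegrable w volume)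
    (t : EuclideanSpace ℝ (Fin d)) : LocallyIntegrable (fun x => w (x - t)) volume := by
  rw [locallyIntegrable_iff] at hw ⊢
  intro K hK
  have h1 := hw _ (hK.image (f := fun x => x - t) (by fun_prop))
  have h2 := (measurePreserving_sub_right (volume : Measure (EuclideanSpace ℝ (Fin d)))
    t).integrableOn_comp_preimage (MeasurableEquiv.subRight t).measurableEmbedding
    (f := w) (s := (fun x => x - t) '' K)
  have h3 := h2.2 h1
  exact h3.mono_set (Set.subset_preimage_image _ _)

theorem HasWeakGradient.translate (hu : HasWeakGradient u g) (t : EuclideanSpace ℝ (Fin d)) :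
    HasWeakGradient (fun x => u (x - t)) (fun x => g (x - t)) := by
  refine ⟨locallyIntegrable_comp_sub_right hu.1 t, locallyIntegrable_comp_sub_right hu.2.1 t,
    fun ψ hψ hψc i => ?_⟩
  let η : EuclideanSpace ℝ (Fin d) → ℝ := fun x => ψ (x + t)
  have hη : ContDiff ℝ ∞ η := hψ.comp (contDiff_id.add contDiff_const)
  have hηc : HasCompactSupport η := hψc.comp_homeomorph (Homeomorph.addRight t)
  have hη' : ∀ x, fderiv ℝ η x = fderiv ℝ ψ (x + t) := fun x => fderiv_comp_add_right t
  have h1 := hu.2.2 η hη hηc i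
  simp only [hη'] at h1
  rw [← integral_sub_right_eq_self _ t] at h1
  rw [← integral_sub_right_eq_self (fun x => η x • g x i) t] at h1
  simpa only [sub_add_cancel, η] using h1

/-- The product rule for a test function and a function with weak gradient. -/
theorem HasWeakGradient.smul_smooth (hu : HasWeakGradient u g)
    {χ : EuclideanSpace ℝ (Fin d) → ℝ} (hχ : ContDiff ℝ ∞ χ) (hχc : HasCompactSupport χ) :
    HasWeakGradient (fun x => χ x • u x) (fun x => χ x • g x +
      ∑ i, EuclideanSpace.single i ((fderiv ℝ χ x (EuclideanSpace.single i 1)) • u x)) := by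
  have h1 : Integrable fun x => χ x • u x :=
    hu.1.integrable_smul_left_of_hasCompactSupport hχ.continuous hχc
  have h2 : Integrable fun x => χ x • g x :=
    hu.2.1.integrable_smul_left_of_hasCompactSupport hχ.continuous hχc
  have h3 : ∀ i : Fin d, Integrable fun x => (EuclideanSpace.single i
      ((fderiv ℝ χ x (EuclideanSpace.single i 1)) • u x) : EuclideanSpace ℂ (Fin d)) := fun i => by
    refine (integrable_fderiv_smul hu.1 hχ hχc (EuclideanSpace.single i 1)).mono ?_
      (Eventually.of_forall fun x => by simp)
    have hc : Continuous fun z : ℂ => (EuclideanSpace.single i z : EuclideanSpace ℂ (Fin d)) :=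
      (LipschitzWith.of_dist_le_mul (K := 1) fun a b => by simp).continuous
    exact hc.comp_aestronglyMeasurable
      (integrable_fderiv_smul hu.1 hχ hχc _).aestronglyMeasurable
  refine ⟨h1.locallyIntegrable, (h2.add (integrable_finsetSum _ fun i _ =>
    h3 i)).locallyIntegrable, fun ψ hψ hψc i => ?_⟩
  have hprod : ContDiff ℝ ∞ fun x => ψ x * χ x := hψ.mul hχ
  have hprodc : HasCompactSupport fun x => ψ x * χ x := hψc.mul_right
  have h4 := hu.2.2 _ hprod hprodc i
  have e1 : ∀ x, fderiv ℝ (fun x => ψ x * χ x) x (EuclideanSpace.single i 1) =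
      ψ x * fderiv ℝ χ x (EuclideanSpace.single i 1) +
        χ x * fderiv ℝ ψ x (EuclideanSpace.single i 1) := by
    intro x
    rw [fderiv_fun_mul (hψ.differentiable (by simp) x) (hχ.differentiable (by simp) x)]
    simp
  have e2 : ∀ x, (χ x • g x + ∑ j, EuclideanSpace.single j
      ((fderiv ℝ χ x (EuclideanSpace.single j 1)) • u x) : EuclideanSpace ℂ (Fin d)) i =
      χ x • g x i + (fderiv ℝ χ x (EuclideanSpace.single i 1)) • u x := by
    intro x
    simp [Finset.sum_apply, Pi.single_apply]
  simp only [e1, add_smul] at h4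
  have i1 : Integrable fun x => (ψ x * fderiv ℝ χ x (EuclideanSpace.single i 1)) • u x :=
    hu.1.integrable_smul_left_of_hasCompactSupport
      (hψ.continuous.mul ((hχ.continuous_fderiv (by simp)).clm_apply continuous_const))
      hψc.mul_right
  have i2 : Integrable fun x => (χ x * fderiv ℝ ψ x (EuclideanSpace.single i 1)) • u x :=
    hu.1.integrable_smul_left_of_hasCompactSupport
      (hχ.continuous.mul ((hψ.continuous_fderiv (by simp)).clm_apply continuous_const))
      hχc.mul_right
  have i3 : Integrable fun x => (ψ x * χ x) • g x i := integrable_smul_apply hu.2.1 hprod hprodc i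
  rw [integral_add i1 i2] at h4
  simp only [e2]
  have e3 : ∀ x, ψ x • (χ x • g x i + (fderiv ℝ χ x (EuclideanSpace.single i 1)) • u x) =
      (ψ x * χ x) • g x i + (ψ x * fderiv ℝ χ x (EuclideanSpace.single i 1)) • u x := fun x => by
    rw [smul_add, smul_smul, smul_smul]
  have e4 : ∀ x, (fderiv ℝ ψ x (EuclideanSpace.single i 1)) • χ x • u x =
      (χ x * fderiv ℝ ψ x (EuclideanSpace.single i 1)) • u x := fun x => by
    rw [smul_smul, mul_comm]
  simp only [e3, e4]
  rw [integral_add i3 i1, neg_add, ← h4]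
  ring

end WeakGradientCalculus

/-! ### Translations on `L²` -/

section TranslatesInLp

variable {d : ℕ} {F : Type*} [NormedAddCommGroup F]

/-- A bounded weight vanishing at infinity kills the translates of an `L²` function. -/
theorem tendsto_eLpNorm_weight_smul_translate [NormedSpace ℝ F] {a : EuclideanSpace ℝ (Fin d) → ℝ}
    (ha : Measurable a) {A : ℝ} (hA : ∀ y, |a y| ≤ A)
    (h0 : Tendsto a (Bornology.cobounded _) (𝓝 0)) {G : EuclideanSpace ℝ (Fin d) → F}
    (hG : MemLp G 2 volume) :
    Tendsto (fun x => eLpNorm (fun y => a y • G (y - x)) 2 volume) (Bornology.cobounded _)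
      (𝓝 0) := by
  have hGm : AEMeasurable (fun z => ‖G z‖ₑ ^ (2 : ℝ)) volume := hG.1.enorm.pow_const _
  obtain ⟨m, hm, hGm'⟩ := hGm
  -- move the translation to the weight, so that dominated convergence applies
  have e : ∀ x, eLpNorm (fun y => a y • G (y - x)) 2 volume =
      (∫⁻ z, ‖a (z + x)‖ₑ ^ (2 : ℝ) * m z) ^ (1 / 2 : ℝ) := by
    intro x
    rw [eLpNorm_eq_lintegral_rpow_enorm_toReal (by norm_num) (by norm_num)]
    simp only [ENNReal.toReal_ofNat]
    congr 1
    rw [← lintegral_add_right_eq_self _ x]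
    refine lintegral_congr_ae ?_
    filter_upwards [hGm'] with z hz
    rw [add_sub_cancel_right, enorm_smul, ENNReal.mul_rpow_of_nonneg _ _ (by norm_num), hz]
  have hfin : ∫⁻ z, m z ≠ ⊤ := by
    have := (eLpNorm_lt_top_iff_lintegral_rpow_enorm_lt_top (by norm_num) (by norm_num)).1 hG.2
    rw [← lintegral_congr_ae hGm']
    simpa using this.ne
  have key : Tendsto (fun x => ∫⁻ z, ‖a (z + x)‖ₑ ^ (2 : ℝ) * m z)
      (Bornology.cobounded _) (𝓝 (∫⁻ _ : EuclideanSpace ℝ (Fin d), 0)) := by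
    have : (Bornology.cobounded (EuclideanSpace ℝ (Fin d))).IsCountablyGenerated := by
      rw [← comap_norm_atTop]
      infer_instance
    refine tendsto_lintegral_filter_of_dominated_convergence
      (fun z => ENNReal.ofReal A ^ (2 : ℝ) * m z) (Eventually.of_forall fun x => ?_)
      (Eventually.of_forall fun x => Eventually.of_forall fun z => ?_) ?_ ?_
    · exact ((ha.comp (measurable_add_const x)).enorm.pow_const _).mul hm
    · gcongr
      rw [← ofReal_norm]
      exact ENNReal.ofReal_le_ofReal (hA _)
    · rw [lintegral_const_mul' _ _ (by simp)]
      exact ENNReal.mul_ne_top (by simp) hfin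
    · filter_upwards [ae_lt_top hm hfin] with z hz
      have h1 : Tendsto (fun x => a (z + x)) (Bornology.cobounded _) (𝓝 0) :=
        h0.comp (tendsto_const_add_cobounded z)
      have h2 : Tendsto (fun x => ‖a (z + x)‖ₑ ^ (2 : ℝ)) (Bornology.cobounded _) (𝓝 0) := by
        have h3 := ((continuous_enorm.tendsto (0 : ℝ)).comp h1)
        have h4 := (ENNReal.continuous_rpow_const (y := 2)).tendsto ‖(0 : ℝ)‖ₑ
        rw [enorm_zero, ENNReal.zero_rpow_of_pos (by norm_num)] at h4
        rw [enorm_zero] at h3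
        exact h4.comp h3
      simpa using ENNReal.Tendsto.mul_const h2 (Or.inr hz.ne)
  simp only [e]
  rw [lintegral_zero] at key
  have h4 := (ENNReal.continuous_rpow_const (y := (1 / 2 : ℝ))).tendsto 0
  rw [ENNReal.zero_rpow_of_pos (by norm_num)] at h4
  exact h4.comp key

variable [InnerProductSpace ℂ F]

/-- Translation `u ↦ u (· - x)` as an isometry of `L²`. -/
def translateLp (F : Type*) [NormedAddCommGroup F] [InnerProductSpace ℂ F]
    (x : EuclideanSpace ℝ (Fin d)) :
    Lp F 2 (volume : Measure (EuclideanSpace ℝ (Fin d))) →ₗᵢ[ℂ]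
      Lp F 2 (volume : Measure (EuclideanSpace ℝ (Fin d))) :=
  Lp.compMeasurePreservingₗᵢ ℂ (fun y => y - x) (measurePreserving_sub_right volume x)

theorem coeFn_translateLp (x : EuclideanSpace ℝ (Fin d))
    (u : Lp F 2 (volume : Measure (EuclideanSpace ℝ (Fin d)))) :
    translateLp F x u =ᵐ[volume] fun y => u (y - x) :=
  Lp.coeFn_compMeasurePreserving u (measurePreserving_sub_right volume x)

theorem translateLp_zero (u : Lp F 2 (volume : Measure (EuclideanSpace ℝ (Fin d)))) :
    translateLp F 0 u = u := by
  refine Lp.ext ((coeFn_translateLp 0 u).trans ?_)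
  simp

theorem translateLp_add (x y : EuclideanSpace ℝ (Fin d))
    (u : Lp F 2 (volume : Measure (EuclideanSpace ℝ (Fin d)))) :
    translateLp F (x + y) u = translateLp F x (translateLp F y u) := by
  refine Lp.ext ?_
  have h := (measurePreserving_sub_right (volume : Measure (EuclideanSpace ℝ (Fin d)))
    x).quasiMeasurePreserving.ae (coeFn_translateLp y u)
  filter_upwards [coeFn_translateLp (x + y) u, coeFn_translateLp x (translateLp F y u), h]
    with z h1 h2 h3
  rw [h1, h2, h3, sub_sub]

theorem continuous_translateLp (u : Lp F 2 (volume : Measure (EuclideanSpace ℝ (Fin d)))) :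
    Continuous fun x => translateLp F x u := by
  let G : C(EuclideanSpace ℝ (Fin d) × EuclideanSpace ℝ (Fin d), EuclideanSpace ℝ (Fin d)) :=
    ⟨fun q => q.2 - q.1, by fun_prop⟩
  exact continuous_const.compMeasurePreservingLp G.curry.continuous
    (fun x => measurePreserving_sub_right volume x) (by norm_num)

theorem exists_norm_sub_le_of_compact_support
    (u : Lp F 2 (volume : Measure (EuclideanSpace ℝ (Fin d)))) {ε : ℝ} (hε : 0 < ε) :
    ∃ (u' : Lp F 2 (volume : Measure (EuclideanSpace ℝ (Fin d)))) (R : ℝ),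
      ‖u - u'‖ ≤ ε ∧ ∀ᵐ y, R < ‖y‖ → u' y = 0 := by
  let _ : NormedSpace ℝ F := NormedSpace.complexToReal
  obtain ⟨k, hk, hke, -, hkm⟩ := (Lp.memLp u).exists_hasCompactSupport_eLpNorm_sub_le
    (by norm_num) (ε := ENNReal.ofReal ε) (by simpa using hε)
  obtain ⟨R, hR⟩ := hk.isBounded.exists_norm_le
  refine ⟨hkm.toLp k, R, ?_, ?_⟩
  · rw [Lp.norm_def, ← ENNReal.toReal_ofReal hε.le]
    refine ENNReal.toReal_mono ENNReal.ofReal_ne_top (le_trans (le_of_eq ?_) hke)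
    refine eLpNorm_congr_ae ?_
    filter_upwards [Lp.coeFn_sub u (hkm.toLp k), hkm.coeFn_toLp] with y h1 h2
    rw [h1, Pi.sub_apply, Pi.sub_apply, h2]
  · filter_upwards [hkm.coeFn_toLp] with y hy hyR
    rw [hy]
    by_contra hne
    exact absurd (hR y (subset_tsupport k hne)) (by linarith)

/-- Translates going to infinity converge weakly to zero in `L²`. -/
theorem tendsto_inner_translateLp
    (f u : Lp F 2 (volume : Measure (EuclideanSpace ℝ (Fin d)))) :
    Tendsto (fun x => ⟪f, translateLp F x u⟫_ℂ) (Bornology.cobounded _) (𝓝 0) := by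
  rw [Metric.tendsto_nhds]
  intro ε hε
  obtain ⟨δ, hδ0, hδ⟩ : ∃ δ : ℝ, 0 < δ ∧ δ * (‖u‖ + ‖f‖ + 1) < ε ∧ δ ≤ 1 := by
    refine ⟨min 1 (ε / (2 * (‖u‖ + ‖f‖ + 1))), by positivity, ?_, min_le_left _ _⟩
    have h1 : 0 < ‖u‖ + ‖f‖ + 1 := by positivity
    calc _ ≤ ε / (2 * (‖u‖ + ‖f‖ + 1)) * (‖u‖ + ‖f‖ + 1) :=
          mul_le_mul_of_nonneg_right (min_le_right _ _) h1.le
      _ = ε / 2 := by field_simp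
      _ < ε := half_lt_self hε
  -- `δ` absorbs the error of replacing both functions by compactly supported ones
  obtain ⟨f', R, hf', hfR⟩ := exists_norm_sub_le_of_compact_support f hδ0
  obtain ⟨u', S, hu', huS⟩ := exists_norm_sub_le_of_compact_support u hδ0
  filter_upwards [(tendsto_norm_cobounded_atTop (E := EuclideanSpace ℝ (Fin d))).eventually_gt_atTop
    (R + S)] with x hx
  -- for large `x` the truncated functions have disjoint supports
  have hz : ⟪f', translateLp F x u'⟫_ℂ = 0 := by
    rw [L2.inner_def]
    refine integral_eq_zero_of_ae ?_
    have h := (measurePreserving_sub_right (volume : Measure (EuclideanSpace ℝ (Fin d)))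
      x).quasiMeasurePreserving.ae huS
    filter_upwards [hfR, h, coeFn_translateLp x u'] with y h1 h2 h3
    rw [h3]
    by_cases hy : R < ‖y‖
    · rw [h1 hy, inner_zero_left]
      rfl
    · have : S < ‖y - x‖ := by
        have := norm_sub_norm_le x y
        rw [norm_sub_rev] at this
        linarith
      rw [h2 this, inner_zero_right]
      rfl
  have e : ⟪f, translateLp F x u⟫_ℂ = ⟪f - f', translateLp F x u⟫_ℂ +
      ⟪f', translateLp F x (u - u')⟫_ℂ := by
    rw [map_sub, inner_sub_left, inner_sub_right, hz]
    ring
  have hf'n : ‖f'‖ ≤ ‖f‖ + δ := by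
    have := norm_sub_norm_le f' f
    rw [norm_sub_rev] at this
    linarith
  rw [dist_zero_right, e]
  calc _ ≤ ‖f - f'‖ * ‖u‖ + ‖f'‖ * ‖u - u'‖ := by
        refine (norm_add_le _ _).trans (add_le_add ?_ ?_)
        · simpa using norm_inner_le_norm (𝕜 := ℂ) (f - f') (translateLp F x u)
        · rw [← (translateLp F x).norm_map (u - u')]
          exact norm_inner_le_norm (𝕜 := ℂ) f' (translateLp F x (u - u'))
    _ ≤ δ * ‖u‖ + (‖f‖ + δ) * δ := by gcongr
    _ < ε := by nlinarith [hδ.1, hδ.2]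

end TranslatesInLp

/-! ### The Hilbert space `H¹` and its operators -/

section SobolevSpace

variable {d : ℕ}

/-- Integration of the components of an `L²` function against a fixed continuous function with
compact support is continuous. -/
theorem continuous_integral_smul_lp {F : Type*} [NormedAddCommGroup F] [InnerProductSpace ℂ F]
    {k : EuclideanSpace ℝ (Fin d) → ℝ} (hk : Continuous k) (hkc : HasCompactSupport k) (e : F) :
    Continuous fun u : Lp F 2 (volume : Measure (EuclideanSpace ℝ (Fin d))) =>
      ∫ x, k x • ⟪e, u x⟫_ℂ := by
  have hm : MemLp (fun x => (k x : ℂ) • e) 2 volume := by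
    refine Continuous.memLp_of_hasCompactSupport (by fun_prop) ?_
    exact HasCompactSupport.smul_right (hkc.comp_left (g := fun r : ℝ => (r : ℂ)) (by simp))
  have h1 : ∀ u : Lp F 2 (volume : Measure (EuclideanSpace ℝ (Fin d))),
      ∫ x, k x • ⟪e, u x⟫_ℂ = ⟪hm.toLp _, u⟫_ℂ := by
    intro u
    rw [L2.inner_def]
    refine integral_congr_ae ?_
    filter_upwards [hm.coeFn_toLp] with x hx
    rw [hx, inner_smul_left, Complex.conj_ofReal, Complex.real_smul]
  simp only [h1]
  fun_prop

/-- The Sobolev space `H¹(ℝᵈ)`, realised as the closed subspace of `L² × L²` of the pairs `(u, ∇u)`.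
Its norm is `(‖u‖² + ‖∇u‖²)^{1/2}`. -/
def sobolevH1 (d : ℕ) : Submodule ℂ
    (WithLp 2 (Lp ℂ 2 (volume : Measure (EuclideanSpace ℝ (Fin d))) ×
      Lp (EuclideanSpace ℂ (Fin d)) 2 (volume : Measure (EuclideanSpace ℝ (Fin d))))) where
  carrier := {f | HasWeakGradient f.fst f.snd}
  add_mem' {f k} hf hk := by
    refine (HasWeakGradient.add hf hk).congr_ae ?_ ?_
    · exact (Lp.coeFn_add f.fst k.fst).symm
    · exact (Lp.coeFn_add f.snd k.snd).symm
  zero_mem' := HasWeakGradient.zero.congr_ae (Lp.coeFn_zero ..).symm (Lp.coeFn_zero ..).symm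
  smul_mem' c f hf := by
    refine (HasWeakGradient.const_smul hf c).congr_ae ?_ ?_
    · exact (Lp.coeFn_smul c f.fst).symm
    · exact (Lp.coeFn_smul c f.snd).symm

theorem isClosed_sobolevH1 (d : ℕ) : IsClosed (sobolevH1 d : Set
    (WithLp 2 (Lp ℂ 2 (volume : Measure (EuclideanSpace ℝ (Fin d))) ×
      Lp (EuclideanSpace ℂ (Fin d)) 2 (volume : Measure (EuclideanSpace ℝ (Fin d)))))) := by
  have h : (sobolevH1 d : Set (WithLp 2 (Lp ℂ 2 (volume : Measure (EuclideanSpace ℝ (Fin d))) ×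
      Lp (EuclideanSpace ℂ (Fin d)) 2 (volume : Measure (EuclideanSpace ℝ (Fin d)))))) =
      ⋂ (ψ : EuclideanSpace ℝ (Fin d) → ℝ) (_ : ContDiff ℝ ∞ ψ) (_ : HasCompactSupport ψ)
        (i : Fin d), {f | ∫ x, (fderiv ℝ ψ x (EuclideanSpace.single i 1)) • ⟪(1 : ℂ), f.fst x⟫_ℂ =
          -∫ x, ψ x • ⟪(EuclideanSpace.single i 1 : EuclideanSpace ℂ (Fin d)), f.snd x⟫_ℂ} := by
    ext f
    simp only [Set.mem_iInter, Set.mem_ofPred_eq]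
    have e1 : ∀ z : ℂ, ⟪(1 : ℂ), z⟫_ℂ = z := fun z => by simp
    have e2 : ∀ (i : Fin d) (z : EuclideanSpace ℂ (Fin d)),
        ⟪(EuclideanSpace.single i 1 : EuclideanSpace ℂ (Fin d)), z⟫_ℂ = z i := fun i z => by
      simp [EuclideanSpace.inner_single_left]
    simp only [e1, e2]
    exact ⟨fun hf => hf.2.2, fun hf => ⟨(Lp.memLp f.fst).locallyIntegrable (by norm_num),
      (Lp.memLp f.snd).locallyIntegrable (by norm_num), hf⟩⟩
  rw [h]
  refine isClosed_iInter fun ψ => isClosed_iInter fun hψ => isClosed_iInter fun hψc =>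
    isClosed_iInter fun i => isClosed_eq ?_ ?_
  · exact (continuous_integral_smul_lp ((hψ.continuous_fderiv (by simp)).clm_apply
      continuous_const) (hψc.fderiv_apply (𝕜 := ℝ) _) (1 : ℂ)).comp (WithLp.continuous_fst 2 _ _)
  · exact ((continuous_integral_smul_lp hψ.continuous hψc
      (EuclideanSpace.single i 1 : EuclideanSpace ℂ (Fin d))).comp
      (WithLp.continuous_snd 2 _ _)).neg

instance : CompleteSpace (sobolevH1 d) := (isClosed_sobolevH1 d).completeSpace_coe

namespace sobolevH1

theorem hasWeakGradient (f : sobolevH1 d) : HasWeakGradient f.1.fst f.1.snd := f.2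

theorem norm_sq (f : sobolevH1 d) : ‖f‖ ^ 2 = ‖f.1.fst‖ ^ 2 + ‖f.1.snd‖ ^ 2 := by
  rw [Submodule.coe_norm, WithLp.prod_norm_sq_eq_of_L2]

theorem inner_def (f k : sobolevH1 d) :
    ⟪f, k⟫_ℂ = ⟪f.1.fst, k.1.fst⟫_ℂ + ⟪f.1.snd, k.1.snd⟫_ℂ := by
  rw [Submodule.coe_inner, WithLp.prod_inner_apply]
  rfl

theorem norm_fst_le (f : sobolevH1 d) : ‖f.1.fst‖ ≤ ‖f‖ := by
  refine le_of_sq_le_sq ?_ (norm_nonneg _)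
  nlinarith [norm_sq f, sq_nonneg ‖f.1.snd‖]

theorem norm_snd_le (f : sobolevH1 d) : ‖f.1.snd‖ ≤ ‖f‖ := by
  refine le_of_sq_le_sq ?_ (norm_nonneg _)
  nlinarith [norm_sq f, sq_nonneg ‖f.1.fst‖]

/-- The inclusion of `H¹` in `L²`. -/
def toL2 (d : ℕ) : sobolevH1 d →L[ℂ] Lp ℂ 2 (volume : Measure (EuclideanSpace ℝ (Fin d))) :=
  LinearMap.mkContinuous
    { toFun := fun f => f.1.fst
      map_add' := fun _ _ => rfl
      map_smul' := fun _ _ => rfl } 1 fun f => (norm_fst_le f).trans_eq (one_mul _).symm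

/-- The gradient, as an operator from `H¹` to `L²`. -/
def grad (d : ℕ) : sobolevH1 d →L[ℂ]
    Lp (EuclideanSpace ℂ (Fin d)) 2 (volume : Measure (EuclideanSpace ℝ (Fin d))) :=
  LinearMap.mkContinuous
    { toFun := fun f => f.1.snd
      map_add' := fun _ _ => rfl
      map_smul' := fun _ _ => rfl } 1 fun f => (norm_snd_le f).trans_eq (one_mul _).symm

theorem toL2_apply (f : sobolevH1 d) : toL2 d f = f.1.fst := rfl

theorem grad_apply (f : sobolevH1 d) : grad d f = f.1.snd := rfl

theorem ext {f k : sobolevH1 d} (h1 : f.1.fst = k.1.fst) (h2 : f.1.snd = k.1.snd) : f = k := by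
  refine Subtype.ext ?_
  exact (WithLp.ofLp_injective 2) (Prod.ext h1 h2)

theorem add_fst (f k : sobolevH1 d) : (f + k).1.fst = f.1.fst + k.1.fst := rfl

theorem add_snd (f k : sobolevH1 d) : (f + k).1.snd = f.1.snd + k.1.snd := rfl

theorem smul_fst (c : ℂ) (f : sobolevH1 d) : (c • f).1.fst = c • f.1.fst := rfl

theorem smul_snd (c : ℂ) (f : sobolevH1 d) : (c • f).1.snd = c • f.1.snd := rfl

/-- The translate `y ↦ f (y - x)` of an element `f` of `H¹`. -/
def translateFun (x : EuclideanSpace ℝ (Fin d)) (f : sobolevH1 d) : sobolevH1 d :=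
  ⟨WithLp.toLp 2 (translateLp ℂ x f.1.fst, translateLp _ x f.1.snd),
    ((hasWeakGradient f).translate x).congr_ae (coeFn_translateLp x _).symm
      (coeFn_translateLp x _).symm⟩

theorem translateFun_fst (x : EuclideanSpace ℝ (Fin d)) (f : sobolevH1 d) :
    (translateFun x f).1.fst = translateLp ℂ x f.1.fst := rfl

theorem translateFun_snd (x : EuclideanSpace ℝ (Fin d)) (f : sobolevH1 d) :
    (translateFun x f).1.snd = translateLp _ x f.1.snd := rfl

theorem translateFun_smul (x : EuclideanSpace ℝ (Fin d)) (c : ℂ) (f : sobolevH1 d) :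
    translateFun x (c • f) = c • translateFun x f := by
  refine sobolevH1.ext ?_ ?_
  · rw [translateFun_fst, smul_fst, smul_fst, translateFun_fst, map_smul]
  · rw [translateFun_snd, smul_snd, smul_snd, translateFun_snd, map_smul]

theorem translateFun_add (x : EuclideanSpace ℝ (Fin d)) (f k : sobolevH1 d) :
    translateFun x (f + k) = translateFun x f + translateFun x k := by
  refine sobolevH1.ext ?_ ?_
  · rw [translateFun_fst, add_fst, add_fst, translateFun_fst, translateFun_fst, map_add]
  · rw [translateFun_snd, add_snd, add_snd, translateFun_snd, translateFun_snd, map_add]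

/-- Translation by `x` as an isometry of `H¹`. -/
def translate (x : EuclideanSpace ℝ (Fin d)) : sobolevH1 d →ₗᵢ[ℂ] sobolevH1 d where
  toFun := translateFun x
  map_add' := translateFun_add x
  map_smul' c f := translateFun_smul x c f
  norm_map' f := by
    change ‖translateFun x f‖ = ‖f‖
    rw [← sq_eq_sq₀ (norm_nonneg _) (norm_nonneg _), norm_sq, norm_sq, translateFun_fst,
      translateFun_snd, LinearIsometry.norm_map, LinearIsometry.norm_map]

theorem translate_fst (x : EuclideanSpace ℝ (Fin d)) (f : sobolevH1 d) :
    (translate x f).1.fst = translateLp ℂ x f.1.fst := rfl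

theorem translate_snd (x : EuclideanSpace ℝ (Fin d)) (f : sobolevH1 d) :
    (translate x f).1.snd = translateLp _ x f.1.snd := rfl

theorem translate_zero (f : sobolevH1 d) : translate 0 f = f := by
  refine sobolevH1.ext ?_ ?_
  · rw [translate_fst, translateLp_zero]
  · rw [translate_snd, translateLp_zero]

theorem translate_add (x y : EuclideanSpace ℝ (Fin d)) (f : sobolevH1 d) :
    translate (x + y) f = translate x (translate y f) := by
  refine sobolevH1.ext ?_ ?_
  · rw [translate_fst (x + y) f, translate_fst x (translate y f), translate_fst y f,
      translateLp_add x y f.1.fst]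
  · rw [translate_snd (x + y) f, translate_snd x (translate y f), translate_snd y f,
      translateLp_add x y f.1.snd]

theorem continuous_translate (f : sobolevH1 d) :
    Continuous fun x : EuclideanSpace ℝ (Fin d) => translate x f := by
  rw [continuous_induced_rng]
  exact (WithLp.prod_continuous_toLp 2 _ _).comp
    ((continuous_translateLp f.1.fst).prodMk (continuous_translateLp f.1.snd))

theorem tendsto_inner_translate (f k : sobolevH1 d) :
    Tendsto (fun x => ⟪f, translate x k⟫_ℂ) (Bornology.cobounded _) (𝓝 0) := by
  have h := (tendsto_inner_translateLp f.1.fst k.1.fst).add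
    (tendsto_inner_translateLp f.1.snd k.1.snd)
  rw [add_zero] at h
  refine h.congr fun x => ?_
  rw [inner_def, translate_fst, translate_snd]

/-- Translations on `H¹` form a vanishing action. -/
def action (d : ℕ) : VanishingAction (EuclideanSpace ℝ (Fin d)) (sobolevH1 d) where
  T := translate
  zero_apply := translate_zero
  add_apply := translate_add
  continuous_apply := continuous_translate
  tendsto_inner := tendsto_inner_translate

theorem eLpNorm_fst (f : sobolevH1 d) :
    eLpNorm f.1.fst 2 volume = ENNReal.ofReal ‖f.1.fst‖ := by
  rw [Lp.norm_def, ENNReal.ofReal_toReal (Lp.memLp _).2.ne]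

theorem eLpNorm_snd (f : sobolevH1 d) :
    eLpNorm f.1.snd 2 volume = ENNReal.ofReal ‖f.1.snd‖ := by
  rw [Lp.norm_def, ENNReal.ofReal_toReal (Lp.memLp _).2.ne]

theorem eLpNorm_hardy_le (hd : 3 ≤ d) (f : sobolevH1 d) :
    eLpNorm (fun x => ‖x‖⁻¹ • f.1.fst x) 2 volume ≤ 2 * eLpNorm f.1.snd 2 volume :=
  (hasWeakGradient f).eLpNorm_hardy_le hd (Lp.memLp _)

theorem memLp_hardy (hd : 3 ≤ d) (f : sobolevH1 d) :
    MemLp (fun x => ‖x‖⁻¹ • f.1.fst x) 2 volume := by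
  refine ⟨measurable_norm.inv.aestronglyMeasurable.smul (Lp.aestronglyMeasurable _), ?_⟩
  refine (eLpNorm_hardy_le hd f).trans_lt (ENNReal.mul_lt_top (by norm_num) ?_)
  exact (Lp.memLp _).2

/-- The product of an element of `H¹` with `1 / |x|`, in `L²`. -/
def hardyFun (hd : 3 ≤ d) (f : sobolevH1 d) :
    Lp ℂ 2 (volume : Measure (EuclideanSpace ℝ (Fin d))) :=
  (memLp_hardy hd f).toLp _

theorem coeFn_hardyFun (hd : 3 ≤ d) (f : sobolevH1 d) :
    hardyFun hd f =ᵐ[volume] fun x => ‖x‖⁻¹ • f.1.fst x :=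
  MemLp.coeFn_toLp _

theorem norm_hardyFun (hd : 3 ≤ d) (f : sobolevH1 d) :
    ‖hardyFun hd f‖ = (eLpNorm (fun x => ‖x‖⁻¹ • f.1.fst x) 2 volume).toReal :=
  Lp.norm_toLp _ (memLp_hardy hd f)

theorem hardyFun_add (hd : 3 ≤ d) (f k : sobolevH1 d) :
    hardyFun hd (f + k) = hardyFun hd f + hardyFun hd k := by
  refine Lp.ext ?_
  filter_upwards [Lp.coeFn_add f.1.fst k.1.fst, coeFn_hardyFun hd (f + k), coeFn_hardyFun hd f,
    coeFn_hardyFun hd k, Lp.coeFn_add (hardyFun hd f) (hardyFun hd k)] with x h1 h2 h3 h4 h5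
  rw [h5, Pi.add_apply, h2, h3, h4, add_fst, h1, Pi.add_apply, smul_add]

theorem hardyFun_smul (hd : 3 ≤ d) (c : ℂ) (f : sobolevH1 d) :
    hardyFun hd (c • f) = c • hardyFun hd f := by
  refine Lp.ext ?_
  filter_upwards [Lp.coeFn_smul c f.1.fst, coeFn_hardyFun hd (c • f), coeFn_hardyFun hd f,
    Lp.coeFn_smul c (hardyFun hd f)] with x h1 h2 h3 h4
  rw [h4, Pi.smul_apply, h2, h3, smul_fst, h1, Pi.smul_apply, smul_comm]

/-- The operator `u ↦ u / |x|` from `H¹` to `L²`, bounded by Hardy's inequality. -/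
def hardyOp (hd : 3 ≤ d) :
    sobolevH1 d →L[ℂ] Lp ℂ 2 (volume : Measure (EuclideanSpace ℝ (Fin d))) :=
  LinearMap.mkContinuous
    { toFun := hardyFun hd
      map_add' := hardyFun_add hd
      map_smul' := fun c f => hardyFun_smul hd c f } 2 fun f => by
    refine le_trans ?_ (mul_le_mul_of_nonneg_left (norm_snd_le f) (by norm_num))
    change ‖hardyFun hd f‖ ≤ _
    rw [norm_hardyFun]
    refine ENNReal.toReal_le_of_le_ofReal (by positivity) ((eLpNorm_hardy_le hd f).trans ?_)
    rw [eLpNorm_snd, ENNReal.ofReal_mul (by norm_num)]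
    simp

theorem norm_hardyOp (hd : 3 ≤ d) (f : sobolevH1 d) :
    ‖hardyOp hd f‖ = (eLpNorm (fun x => ‖x‖⁻¹ • f.1.fst x) 2 volume).toReal := by
  exact norm_hardyFun hd f

end sobolevH1

theorem tendsto_cobounded_of_hasCompactSupport {k : EuclideanSpace ℝ (Fin d) → ℝ}
    (hk : HasCompactSupport k) : Tendsto k (Bornology.cobounded _) (𝓝 0) := by
  refine Tendsto.congr' ?_ tendsto_const_nhds
  filter_upwards [Bornology.isBounded_def.1 hk.isCompact.isBounded] with x hx
  exact (image_eq_zero_of_notMem_tsupport hx).symm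

variable {u : EuclideanSpace ℝ (Fin d) → ℂ}
  {g : EuclideanSpace ℝ (Fin d) → EuclideanSpace ℂ (Fin d)}

theorem eLpNorm_smul_add_sum_single_le {η : EuclideanSpace ℝ (Fin d) → ℝ}
    {b : Fin d → EuclideanSpace ℝ (Fin d) → ℝ} (hη : Continuous η) (hb : ∀ i, Continuous (b i))
    (hu : AEStronglyMeasurable u volume) (hg : AEStronglyMeasurable g volume) :
    eLpNorm (fun y => η y • g y +
      ∑ i, (EuclideanSpace.single i (b i y • u y) : EuclideanSpace ℂ (Fin d))) 2 volume ≤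
      eLpNorm (fun y => η y • g y) 2 volume + ∑ i, eLpNorm (fun y => b i y • u y) 2 volume := by
  have hs : ∀ i, AEStronglyMeasurable (fun y => (EuclideanSpace.single i
      (b i y • u y) : EuclideanSpace ℂ (Fin d))) volume := fun i => by
    have hc : Continuous fun z : ℂ => (EuclideanSpace.single i z : EuclideanSpace ℂ (Fin d)) :=
      (LipschitzWith.of_dist_le_mul (K := 1) fun a b => by simp).continuous
    exact hc.comp_aestronglyMeasurable ((hb i).aestronglyMeasurable.smul hu)
  refine (eLpNorm_add_le (hη.aestronglyMeasurable.smul hg)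
    (Finset.aestronglyMeasurable_fun_sum _ fun i _ => hs i) (by norm_num)).trans ?_
  refine add_le_add le_rfl ?_
  have h6 := eLpNorm_sum_le (μ := volume) (p := 2) (s := Finset.univ)
    (f := fun (i : Fin d) y => (EuclideanSpace.single i
    (b i y • u y) : EuclideanSpace ℂ (Fin d))) (fun i _ => hs i) (by norm_num)
  have h7 : (∑ i : Fin d, fun y => (EuclideanSpace.single i
      (b i y • u y) : EuclideanSpace ℂ (Fin d))) = fun y => ∑ i,
        (EuclideanSpace.single i (b i y • u y) : EuclideanSpace ℂ (Fin d)) := by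
    ext1 y
    rw [Finset.sum_apply]
  rw [h7] at h6
  refine h6.trans (Finset.sum_le_sum fun i _ => le_of_eq ?_)
  exact eLpNorm_congr_norm_ae (Eventually.of_forall fun y => by simp)

/-- Hardy's inequality localised by a cutoff `η`. -/
theorem HasWeakGradient.eLpNorm_hardy_cutoff_le (h : HasWeakGradient u g) (hd : 3 ≤ d)
    (hu : MemLp u 2 volume) {η : EuclideanSpace ℝ (Fin d) → ℝ} (hη : ContDiff ℝ ∞ η)
    (hηc : HasCompactSupport η) (hη1 : ∀ y, |η y| ≤ 1) :
    eLpNorm (fun y => ‖y‖⁻¹ • u y) 2 volume ≤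
      2 * (eLpNorm (fun y => η y • g y) 2 volume +
        ∑ i : Fin d, eLpNorm (fun y => (fderiv ℝ η y (EuclideanSpace.single i 1)) • u y) 2 volume) +
      eLpNorm (fun y => (‖y‖⁻¹ * (1 - η y)) • u y) 2 volume := by
  have hηu : MemLp (fun y => η y • u y) 2 volume := by
    refine hu.of_le (hη.continuous.aestronglyMeasurable.smul hu.1)
      (Eventually.of_forall fun y => ?_)
    rw [norm_smul, Real.norm_eq_abs]
    exact mul_le_of_le_one_left (norm_nonneg _) (hη1 y)
  have hw := (h.smul_smooth hη hηc).eLpNorm_hardy_le hd hηu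
  have hgrad := eLpNorm_smul_add_sum_single_le
    (b := fun i y => fderiv ℝ η y (EuclideanSpace.single i 1)) hη.continuous
    (fun i => (hη.continuous_fderiv (by simp)).clm_apply continuous_const) hu.1
    h.2.1.aestronglyMeasurable
  have hsplit : (fun y => ‖y‖⁻¹ • u y) =
      fun y => ‖y‖⁻¹ • (η y • u y) + (‖y‖⁻¹ * (1 - η y)) • u y := by
    ext1 y
    rw [smul_smul, ← add_smul]
    congr 1
    ring
  have hm : AEStronglyMeasurable (fun y : EuclideanSpace ℝ (Fin d) => ‖y‖⁻¹ * (1 - η y)) volume :=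
    (measurable_norm.inv.mul (measurable_const.sub hη.continuous.measurable)).aestronglyMeasurable
  have hm' : AEStronglyMeasurable (fun y : EuclideanSpace ℝ (Fin d) => ‖y‖⁻¹) volume :=
    measurable_norm.inv.aestronglyMeasurable
  rw [hsplit]
  refine (eLpNorm_add_le (hm'.smul hηu.1) (hm.smul hu.1) (by norm_num)).trans ?_
  exact add_le_add (hw.trans (mul_le_mul_right hgrad 2)) le_rfl

/-- The Hardy potential is negligible on translates going to infinity: near the origin one applies
Hardy's inequality to a cutoff of the translate, away from the origin the potential is a bounded
weight vanishing at infinity. -/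
theorem HasWeakGradient.tendsto_eLpNorm_hardy_translate (h : HasWeakGradient u g) (hd : 3 ≤ d)
    (hu : MemLp u 2 volume) (hg : MemLp g 2 volume) :
    Tendsto (fun x => eLpNorm (fun y => ‖y‖⁻¹ • u (y - x)) 2 volume) (Bornology.cobounded _)
      (𝓝 0) := by
  obtain ⟨χ, C, hC0, hχ⟩ := exists_cutoff d
  obtain ⟨h1, h2, h3, h4, h5⟩ := hχ 0
  generalize χ 0 = η at h1 h2 h3 h4 h5
  have hbc : ∀ i : Fin d, Continuous fun y => fderiv ℝ η y (EuclideanSpace.single i 1) := fun i =>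
    (h1.continuous_fderiv (by simp)).clm_apply continuous_const
  have hbC : ∀ (i : Fin d) y, |fderiv ℝ η y (EuclideanSpace.single i 1)| ≤ C := fun i y => by
    have := ((fderiv ℝ η y).le_opNorm (EuclideanSpace.single i 1)).trans
      (mul_le_mul_of_nonneg_right (h5 y) (norm_nonneg _))
    simpa using this
  have ham : Measurable fun y : EuclideanSpace ℝ (Fin d) => ‖y‖⁻¹ * (1 - η y) :=
    measurable_norm.inv.mul (measurable_const.sub h1.continuous.measurable)
  have ha2 : ∀ y, |‖y‖⁻¹ * (1 - η y)| ≤ 2 * ‖y‖⁻¹ := fun y => by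
    rw [abs_mul, abs_of_nonneg (by positivity : 0 ≤ ‖y‖⁻¹), mul_comm]
    refine mul_le_mul_of_nonneg_right ?_ (by positivity)
    have := abs_le.1 (h3 y)
    exact abs_le.2 ⟨by linarith, by linarith⟩
  have haC : ∀ y, |‖y‖⁻¹ * (1 - η y)| ≤ 2 := fun y => by
    by_cases hy : ‖y‖ ≤ 1
    · have : η y = 1 := h4 y (by simpa using hy)
      simp [this]
    · push Not at hy
      have := inv_le_one_of_one_le₀ hy.le
      linarith [ha2 y]
  have ha0 : Tendsto (fun y => ‖y‖⁻¹ * (1 - η y)) (Bornology.cobounded _) (𝓝 0) := by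
    refine squeeze_zero_norm ha2 ?_
    simpa using (tendsto_inv_atTop_zero.comp
      (tendsto_norm_cobounded_atTop (E := EuclideanSpace ℝ (Fin d)))).const_mul 2
  have l1 := tendsto_eLpNorm_weight_smul_translate h1.continuous.measurable h3
    (tendsto_cobounded_of_hasCompactSupport h2) hg
  have l2 := tendsto_finsetSum (Finset.univ : Finset (Fin d)) fun i _ =>
    tendsto_eLpNorm_weight_smul_translate (hbc i).measurable (hbC i)
      (tendsto_cobounded_of_hasCompactSupport
        (h2.fderiv_apply (𝕜 := ℝ) (EuclideanSpace.single i 1))) hu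
  have l3 := tendsto_eLpNorm_weight_smul_translate ham haC ha0 hu
  have l4 := (ENNReal.Tendsto.const_mul (a := 2) (l1.add l2) (Or.inr (by norm_num))).add l3
  simp only [Finset.sum_const_zero, add_zero, mul_zero] at l4
  exact tendsto_of_tendsto_of_tendsto_of_le_of_le tendsto_const_nhds l4 (fun _ => zero_le)
    fun x => (h.translate x).eLpNorm_hardy_cutoff_le hd
      (hu.comp_measurePreserving (measurePreserving_sub_right volume x)) h1 h2 h3

theorem sobolevH1.tendsto_hardyOp_translate (hd : 3 ≤ d) (f : sobolevH1 d) :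
    Tendsto (fun x => hardyOp hd (translate x f)) (Bornology.cobounded _) (𝓝 0) := by
  have h := (hasWeakGradient f).tendsto_eLpNorm_hardy_translate hd (Lp.memLp _) (Lp.memLp _)
  have h' := (ENNReal.tendsto_toReal ENNReal.zero_ne_top).comp h
  rw [ENNReal.toReal_zero] at h'
  rw [tendsto_zero_iff_norm_tendsto_zero]
  refine h'.congr fun x => ?_
  rw [norm_hardyOp, Function.comp_apply]
  congr 1
  refine eLpNorm_congr_ae ?_
  filter_upwards [coeFn_translateLp x f.1.fst] with y hy
  rw [translate_fst, hy]

end SobolevSpace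

/-! ### Interpolation of Lebesgue norms -/

section Interpolation

variable {X F : Type*} [MeasurableSpace X] {μ : Measure X} [NormedAddCommGroup F]

theorem eLpNorm_ofReal_eq {p : ℝ} (hp : 0 < p) (u : X → F) :
    eLpNorm u (ENNReal.ofReal p) μ = (∫⁻ x, ‖u x‖ₑ ^ p ∂μ) ^ p⁻¹ := by
  rw [eLpNorm_eq_lintegral_rpow_enorm_toReal (by simpa using hp) ENNReal.ofReal_ne_top,
    ENNReal.toReal_ofReal hp.le, one_div]

/-- Interpolation (log-convexity) of Lebesgue norms. -/
theorem exists_eLpNorm_interpolate {q p r : ℝ} (hq : 0 < q) (hqp : q < p) (hpr : p < r) :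
    ∃ s t : ℝ, 0 < s ∧ 0 < t ∧ ∀ u : X → F, AEStronglyMeasurable u μ →
      eLpNorm u (ENNReal.ofReal p) μ ≤
        eLpNorm u (ENNReal.ofReal q) μ ^ s * eLpNorm u (ENNReal.ofReal r) μ ^ t := by
  have hp : 0 < p := hq.trans hqp
  have hr : 0 < r := hp.trans hpr
  have hrq : 0 < r - q := by linarith
  have ha : 0 < (r - p) / (r - q) := div_pos (by linarith) hrq
  have hb : 0 < (p - q) / (r - q) := div_pos (by linarith) hrq
  refine ⟨q * ((r - p) / (r - q)) / p, r * ((p - q) / (r - q)) / p, by positivity, by positivity,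
    fun u hu => ?_⟩
  have h := ENNReal.lintegral_mul_norm_pow_le (μ := μ) (hu.enorm.pow_const q)
    (hu.enorm.pow_const r) ha.le hb.le (by field_simp; ring)
  simp only [← ENNReal.rpow_mul] at h
  have e : ∀ x, ‖u x‖ₑ ^ (q * ((r - p) / (r - q))) * ‖u x‖ₑ ^ (r * ((p - q) / (r - q))) =
      ‖u x‖ₑ ^ p := by
    intro x
    rw [← ENNReal.rpow_add_of_nonneg _ _ (by positivity) (by positivity)]
    congr 1
    field_simp
    ring
  simp only [e] at h
  rw [eLpNorm_ofReal_eq hp, eLpNorm_ofReal_eq hq, eLpNorm_ofReal_eq hr]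
  refine (ENNReal.rpow_le_rpow h (inv_nonneg.2 hp.le)).trans (le_of_eq ?_)
  rw [ENNReal.mul_rpow_of_nonneg _ _ (inv_nonneg.2 hp.le), ← ENNReal.rpow_mul, ← ENNReal.rpow_mul,
    ← ENNReal.rpow_mul, ← ENNReal.rpow_mul]
  congr 2 <;> field_simp

/-- Functions bounded by `B` and in `L²` are in `Lᵖ` for `2 < p`, with a norm controlled by a
positive power of `B`. -/
theorem eLpNorm_le_of_enorm_le {p : ℝ} (hp : 2 < p) {u : X → F} {B : ℝ≥0∞}
    (hBt : B ≠ ⊤) (hB : ∀ x, ‖u x‖ₑ ≤ B) :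
    eLpNorm u (ENNReal.ofReal p) μ ≤ B ^ ((p - 2) / p) * eLpNorm u 2 μ ^ (2 / p) := by
  have hp0 : 0 < p := by linarith
  have h2 : eLpNorm u 2 μ = (∫⁻ x, ‖u x‖ₑ ^ (2 : ℝ) ∂μ) ^ (2 : ℝ)⁻¹ := by
    rw [← eLpNorm_ofReal_eq (by norm_num)]
    simp
  have h : ∫⁻ x, ‖u x‖ₑ ^ p ∂μ ≤ B ^ (p - 2) * ∫⁻ x, ‖u x‖ₑ ^ (2 : ℝ) ∂μ := by
    rw [← lintegral_const_mul' _ _ (ENNReal.rpow_ne_top_of_nonneg (by linarith) hBt)]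
    refine lintegral_mono fun x => ?_
    calc ‖u x‖ₑ ^ p = ‖u x‖ₑ ^ (p - 2) * ‖u x‖ₑ ^ (2 : ℝ) := by
          rw [← ENNReal.rpow_add_of_nonneg _ _ (by linarith) (by norm_num)]
          congr 1
          ring
      _ ≤ B ^ (p - 2) * ‖u x‖ₑ ^ (2 : ℝ) :=
          mul_le_mul_left (ENNReal.rpow_le_rpow (hB x) (by linarith)) _
  rw [eLpNorm_ofReal_eq hp0, h2]
  refine (ENNReal.rpow_le_rpow h (inv_nonneg.2 hp0.le)).trans (le_of_eq ?_)
  rw [ENNReal.mul_rpow_of_nonneg _ _ (inv_nonneg.2 hp0.le), ← ENNReal.rpow_mul,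
    ← ENNReal.rpow_mul]
  congr 2
  field_simp

end Interpolation

/-! ### Vanishing in subcritical Lebesgue spaces -/

section Vanishing

variable {d : ℕ}

namespace sobolevH1

theorem memLp_normed (ρ : ContDiffBump (0 : EuclideanSpace ℝ (Fin d))) :
    MemLp (fun x => (ρ.normed volume x : ℂ)) 2 volume := by
  have h : MemLp (fun x => ρ.normed volume x) 2 volume :=
    ρ.continuous_normed.memLp_of_hasCompactSupport ρ.hasCompactSupport_normed
  exact h.ofReal

/-- The vector of `H¹` representing the functional `u ↦ (ρ ⋆ u)(0)`, where the bump `ρ` is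
normalised to have integral one. -/
def bumpVector (ρ : ContDiffBump (0 : EuclideanSpace ℝ (Fin d))) : sobolevH1 d :=
  ContinuousLinearMap.adjoint (toL2 d) ((memLp_normed ρ).toLp _)

theorem inner_normed_translateLp (ρ : ContDiffBump (0 : EuclideanSpace ℝ (Fin d)))
    (f : Lp ℂ 2 (volume : Measure (EuclideanSpace ℝ (Fin d)))) (y : EuclideanSpace ℝ (Fin d)) :
    ⟪(memLp_normed ρ).toLp _, translateLp ℂ (-y) f⟫_ℂ = mollify ρ f y := by
  rw [L2.inner_def, mollify_apply,
    ← integral_sub_left_eq_self (fun t => ρ.normed volume t • f (y - t)) volume y]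
  simp only [sub_sub_cancel]
  rw [← integral_sub_right_eq_self (μ := volume)
    (fun t => ρ.normed volume (y - t) • f t) (-y)]
  refine integral_congr_ae ?_
  filter_upwards [(memLp_normed ρ).coeFn_toLp, coeFn_translateLp (-y) f] with x h1 h2
  have e : y - (x - -y) = -x := by abel
  rw [h1, h2, e, ρ.normed_neg (μ := volume) x, RCLike.inner_apply, Complex.conj_ofReal,
    Complex.real_smul, mul_comm]

theorem inner_bumpVector_translate (ρ : ContDiffBump (0 : EuclideanSpace ℝ (Fin d)))
    (f : sobolevH1 d) (y : EuclideanSpace ℝ (Fin d)) :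
    ⟪bumpVector ρ, translate (-y) f⟫_ℂ = mollify ρ f.1.fst y := by
  rw [bumpVector, ContinuousLinearMap.adjoint_inner_left (toL2 d) (translate (-y) f) _,
    toL2_apply (translate (-y) f), translate_fst (-y) f, inner_normed_translateLp ρ f.1.fst y]

/-- Values of a mollification are inner products with translates, hence bounded by the supremum over
all frames. -/
theorem enorm_mollify_le (ρ : ContDiffBump (0 : EuclideanSpace ℝ (Fin d))) (f : sobolevH1 d)
    (y : EuclideanSpace ℝ (Fin d)) :
    ‖mollify ρ f.1.fst y‖ₑ ≤
      ENNReal.ofReal (⨆ x, ‖⟪bumpVector ρ, (action d).T x f⟫_ℂ‖) := by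
  have h := (action d).norm_inner_le_iSup (bumpVector ρ) f (-y)
  have e : ⟪bumpVector ρ, (action d).T (-y) f⟫_ℂ = mollify ρ f.1.fst y :=
    inner_bumpVector_translate ρ f y
  have key : ∀ (z : ℂ) (r : ℝ), ‖z‖ ≤ r → ‖z‖ₑ ≤ ENNReal.ofReal r := fun z r hz => by
    rw [← ofReal_norm]
    exact ENNReal.ofReal_le_ofReal hz
  exact key (mollify ρ f.1.fst y) _ ((congrArg norm e).symm.trans_le h)

end sobolevH1

/-- A quantitative vanishing lemma: the `Lᵖ` norm is small if the mollification at scale `rOut` is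
uniformly small and `rOut` itself is small. -/
theorem HasWeakGradient.exists_eLpNorm_le (hd : 3 ≤ d) {p : ℝ} (hp : 2 < p)
    (hp' : p < 2 * (d : ℝ) / ((d : ℝ) - 2)) {M : ℝ≥0∞} (hM : M ≠ ⊤) :
    ∃ (s t : ℝ) (A B : ℝ≥0∞), 0 < s ∧ 0 < t ∧ A ≠ ⊤ ∧ B ≠ ⊤ ∧
      ∀ (u : EuclideanSpace ℝ (Fin d) → ℂ) (g : EuclideanSpace ℝ (Fin d) → EuclideanSpace ℂ (Fin d))
        (ρ : ContDiffBump (0 : EuclideanSpace ℝ (Fin d))) (K : ℝ≥0∞), HasWeakGradient u g →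
        MemLp u 2 volume → eLpNorm u 2 volume ≤ M → eLpNorm g 2 volume ≤ M → K ≠ ⊤ →
        (∀ y, ‖mollify ρ u y‖ₑ ≤ K) →
        eLpNorm u (ENNReal.ofReal p) volume ≤ K ^ s * A + ENNReal.ofReal ρ.rOut ^ t * B := by
  obtain ⟨C, hC, hsob⟩ := exists_eLpNorm_sobolev_le hd
  obtain ⟨t, t', ht, ht', hint⟩ := exists_eLpNorm_interpolate
    (μ := (volume : Measure (EuclideanSpace ℝ (Fin d)))) (F := ℂ) (by norm_num : (0 : ℝ) < 2) hp hp'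
  have h2 : ENNReal.ofReal 2 = 2 := by simp
  have hd3 : (3 : ℝ) ≤ d := by exact_mod_cast hd
  set q : ℝ := 2 * (d : ℝ) / ((d : ℝ) - 2) with hq
  have hq1 : (1 : ℝ≥0∞) ≤ ENNReal.ofReal q := by
    rw [ENNReal.one_le_ofReal]
    linarith
  refine ⟨(p - 2) / p, t, M ^ (2 / p), M ^ t * (C * M + C * M) ^ t',
    div_pos (by linarith) (by linarith), ht, ENNReal.rpow_ne_top_of_nonneg (by positivity) hM,
    ENNReal.mul_ne_top (ENNReal.rpow_ne_top_of_nonneg ht.le hM)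
      (ENNReal.rpow_ne_top_of_nonneg ht'.le (ENNReal.add_ne_top.2
        ⟨ENNReal.mul_ne_top hC hM, ENNReal.mul_ne_top hC hM⟩)),
    fun u g ρ K hw hu hn1 hn2 hKt hK => ?_⟩
  have hum := hu.1
  have hmm : AEStronglyMeasurable (mollify ρ u) volume :=
    (contDiff_mollify ρ hw.1).continuous.aestronglyMeasurable
  -- the mollification is small in `L^∞` and bounded in `L²`
  have hfirst : eLpNorm (mollify ρ u) (ENNReal.ofReal p) volume ≤
      K ^ ((p - 2) / p) * M ^ (2 / p) := by
    refine (eLpNorm_le_of_enorm_le hp hKt hK).trans ?_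
    gcongr
    exact (eLpNorm_mollify_le ρ (by norm_num) (by norm_num) hum).trans hn1
  -- the error is small in `L²` and bounded in the critical Lebesgue space
  have hs1 : eLpNorm u (ENNReal.ofReal q) volume ≤ C * M :=
    (hsob u g hw hu).trans (mul_le_mul_right hn2 C)
  have hsecond : eLpNorm (fun x => mollify ρ u x - u x) (ENNReal.ofReal p) volume ≤
      ENNReal.ofReal ρ.rOut ^ t * (M ^ t * (C * M + C * M) ^ t') := by
    refine (hint _ (hmm.sub hum)).trans ?_
    rw [← mul_assoc, ← ENNReal.mul_rpow_of_nonneg _ _ ht.le, h2]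
    gcongr
    · refine eLpNorm_mollify_sub_le ρ (by norm_num) (by norm_num) hw.1 fun z hz => ?_
      refine (hw.eLpNorm_translate_sub_le hu z).trans ?_
      gcongr
      rw [← ofReal_norm]
      exact ENNReal.ofReal_le_ofReal hz
    · refine (eLpNorm_sub_le hmm hum hq1).trans (add_le_add ?_ hs1)
      exact (eLpNorm_mollify_le ρ hq1 ENNReal.ofReal_ne_top hum).trans hs1
  have hsplit : u = fun x => mollify ρ u x - (mollify ρ u x - u x) := by
    ext1 x
    ring
  have hsub := eLpNorm_sub_le (p := ENNReal.ofReal p) hmm (hmm.sub hum) (by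
    rw [ENNReal.one_le_ofReal]
    linarith)
  calc eLpNorm u (ENNReal.ofReal p) volume
      = eLpNorm (fun x => mollify ρ u x - (mollify ρ u x - u x)) (ENNReal.ofReal p) volume := by
        rw [← hsplit]
    _ ≤ _ := hsub.trans (add_le_add hfirst hsecond)

theorem sobolevH1.exists_eLpNorm_le (hd : 3 ≤ d) {p : ℝ} (hp : 2 < p)
    (hp' : p < 2 * (d : ℝ) / ((d : ℝ) - 2)) (M : ℝ) :
    ∃ (s t : ℝ) (A B : ℝ≥0∞), 0 < s ∧ 0 < t ∧ A ≠ ⊤ ∧ B ≠ ⊤ ∧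
      ∀ (f : sobolevH1 d) (ρ : ContDiffBump (0 : EuclideanSpace ℝ (Fin d))), ‖f‖ ≤ M →
        eLpNorm f.1.fst (ENNReal.ofReal p) volume ≤
          ENNReal.ofReal (⨆ x, ‖⟪bumpVector ρ, (action d).T x f⟫_ℂ‖) ^ s * A +
            ENNReal.ofReal ρ.rOut ^ t * B := by
  obtain ⟨s, t, A, B, hs, ht, hA, hB, h⟩ :=
    HasWeakGradient.exists_eLpNorm_le hd hp hp' (ENNReal.ofReal_ne_top (r := M))
  refine ⟨s, t, A, B, hs, ht, hA, hB, fun f ρ hf => ?_⟩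
  refine h _ _ ρ _ (hasWeakGradient f) (Lp.memLp _) ?_ ?_ ENNReal.ofReal_ne_top
    (enorm_mollify_le ρ f)
  · rw [eLpNorm_fst f]
    exact ENNReal.ofReal_le_ofReal ((norm_fst_le f).trans hf)
  · rw [eLpNorm_snd f]
    exact ENNReal.ofReal_le_ofReal ((norm_snd_le f).trans hf)

end Vanishing

/-! ### Functions representing elements of `H¹` -/

section Representatives

variable {d : ℕ}

namespace sobolevH1

variable {u v : EuclideanSpace ℝ (Fin d) → ℂ} {f k : sobolevH1 d}

theorem memLp_two_norm_sq {X F : Type*} [MeasurableSpace X] [NormedAddCommGroup F]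
    {μ : Measure X} (h : Lp F 2 μ) : ‖h‖ ^ 2 = ∫ x, ‖h x‖ ^ 2 ∂μ := by
  rw [Lp.norm_def, eLpNorm_two_eq_ofReal_sqrt (Lp.memLp h), ENNReal.toReal_ofReal (by positivity),
    Real.sq_sqrt (integral_nonneg fun x => by positivity)]

theorem hasWeakGradient_of_ae (h : u =ᵐ[volume] f.1.fst) : HasWeakGradient u f.1.snd :=
  (hasWeakGradient f).congr_ae h.symm (ae_eq_refl _)

theorem memH1_of_ae (h : u =ᵐ[volume] f.1.fst) : MemH1 u :=
  ⟨(memLp_congr_ae h).2 (Lp.memLp _), f.1.snd, hasWeakGradient_of_ae h, Lp.memLp _⟩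

theorem weakGradient_of_ae (h : u =ᵐ[volume] f.1.fst) : weakGradient u =ᵐ[volume] f.1.snd :=
  (hasWeakGradient_weakGradient ⟨_, hasWeakGradient_of_ae h⟩).ae_unique (hasWeakGradient_of_ae h)

theorem integral_norm_sq_of_ae (h : u =ᵐ[volume] f.1.fst) : ∫ x, ‖u x‖ ^ 2 = ‖toL2 d f‖ ^ 2 := by
  rw [toL2_apply, memLp_two_norm_sq]
  exact integral_congr_ae (h.mono fun x hx => by simp only [hx])

theorem integral_weakGradient_of_ae (h : u =ᵐ[volume] f.1.fst) :
    ∫ x, ‖weakGradient u x‖ ^ 2 = ‖grad d f‖ ^ 2 := by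
  rw [grad_apply, memLp_two_norm_sq]
  exact integral_congr_ae ((weakGradient_of_ae h).mono fun x hx => by simp only [hx])

theorem hardyFunctional_of_ae (hd : 3 ≤ d) (c : ℝ) (h : u =ᵐ[volume] f.1.fst) :
    hardyFunctional c u = ‖grad d f‖ ^ 2 - c * ‖hardyOp hd f‖ ^ 2 := by
  rw [hardyFunctional, integral_weakGradient_of_ae h, memLp_two_norm_sq (hardyOp hd f)]
  congr 2
  refine integral_congr_ae ?_
  filter_upwards [h, coeFn_hardyFun hd f] with x h1 h2
  have h3 : hardyOp hd f x = ‖x‖⁻¹ • f.1.fst x := h2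
  rw [h3, h1, norm_smul (‖x‖⁻¹ : ℝ) (f.1.fst x : ℂ), mul_pow, norm_inv, norm_norm, inv_pow,
    div_eq_inv_mul]

theorem exists_of_memH1 (hu : MemH1 u) : ∃ f : sobolevH1 d, u =ᵐ[volume] f.1.fst := by
  have hg := hasWeakGradient_weakGradient (hu.2.imp fun _ h => h.1)
  refine ⟨⟨WithLp.toLp 2 (hu.1.toLp u, hu.memLp_weakGradient.toLp _),
    hg.congr_ae (MemLp.coeFn_toLp hu.1).symm (MemLp.coeFn_toLp hu.memLp_weakGradient).symm⟩, ?_⟩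
  exact (MemLp.coeFn_toLp hu.1).symm

theorem norm_eq_h1Norm (h : u =ᵐ[volume] f.1.fst) : ‖f‖ = h1Norm u := by
  rw [h1Norm, integral_norm_sq_of_ae h, integral_weakGradient_of_ae h, toL2_apply, grad_apply,
    ← norm_sq, Real.sqrt_sq (norm_nonneg _)]

theorem ae_sub (hu : u =ᵐ[volume] f.1.fst) (hv : v =ᵐ[volume] k.1.fst) :
    (fun x => u x - v x) =ᵐ[volume] (f - k).1.fst := by
  have h : (f - k).1.fst = f.1.fst - k.1.fst := rfl
  rw [h]
  filter_upwards [hu, hv, Lp.coeFn_sub f.1.fst k.1.fst] with x h1 h2 h3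
  rw [h3, Pi.sub_apply, h1, h2]

theorem ae_translate (f : sobolevH1 d) (x : EuclideanSpace ℝ (Fin d)) :
    (fun y => f.1.fst (y - x)) =ᵐ[volume] (translate x f).1.fst :=
  (coeFn_translateLp x f.1.fst).symm

end sobolevH1

end Representatives

/-! ### Decompositions along a subsequence -/

namespace VanishingAction

variable {ι X E F : Type*} [NormedAddCommGroup X] [NormedAddCommGroup E] [InnerProductSpace ℂ E]
  [NormedAddCommGroup F] [InnerProductSpace ℂ F]

/-- The functional `Q` is asymptotically additive along every decomposition of a bounded sequence
into translated profiles and remainders that vanish weakly in the frame of the last profile. -/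
def AsymptoticallyAdditive (τ : VanishingAction X E) (l : Filter ι) (Q : E → ℝ) : Prop :=
  ∀ (v : ι → E) (x : ℕ → ι → X) (V : ℕ → E) (M : ℝ), (∀ n, ‖v n‖ ≤ M) →
    (∀ ℓ, WeakTendsto (fun n => τ.T (-(x ℓ n)) (τ.remainder v x V (ℓ + 1) n)) l 0) →
    ∀ ℓ, Tendsto (fun n => Q (v n) - ((∑ j ∈ Finset.range ℓ, Q (τ.T (x j n) (V j))) +
      Q (τ.remainder v x V ℓ n))) l (𝓝 0)

theorem Decouples.asymptoticallyAdditive {τ : VanishingAction X E} {l : Filter ι} {A : E →L[ℂ] F}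
    (hA : τ.Decouples l A) : τ.AsymptoticallyAdditive l fun u => ‖A u‖ ^ 2 :=
  fun _ _ _ _ hM hw ℓ => τ.tendsto_decoupling hA hM hw ℓ

theorem AsymptoticallyAdditive.sub_const_mul {τ : VanishingAction X E} {l : Filter ι}
    {Q R : E → ℝ} (hQ : τ.AsymptoticallyAdditive l Q) (hR : τ.AsymptoticallyAdditive l R) (c : ℝ) :
    τ.AsymptoticallyAdditive l fun u => Q u - c * R u := by
  intro v x V M hM hw ℓ
  have h := (hQ v x V M hM hw ℓ).sub ((hR v x V M hM hw ℓ).const_mul c)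
  rw [mul_zero, sub_zero] at h
  refine h.congr fun n => ?_
  rw [Finset.sum_sub_distrib, ← Finset.mul_sum]
  ring

/-- **Abstract profile decomposition** along a subsequence. The countably many limits that the
decomposition along an ultrafilter provides are realised along one common subsequence. -/
theorem exists_subsequence_profile_decomposition [NormedSpace ℝ X] [FiniteDimensional ℝ X]
    [Nontrivial X] [CompleteSpace E] (τ : VanishingAction X E) (v : ℕ → E) {M : ℝ}
    (hM : ∀ n, ‖v n‖ ≤ M) (f : ℕ → E) {κ : Type*} [Countable κ] (Q : κ → E → ℝ)
    (hQ : ∀ i (U : Ultrafilter ℕ), τ.AsymptoticallyAdditive (U : Filter ℕ) (Q i)) :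
    ∃ (φ : ℕ → ℕ) (x : ℕ → ℕ → X) (V : ℕ → E), StrictMono φ ∧
      (∀ j k, k ≠ j → Tendsto (fun n => ‖x k n - x j n‖) atTop atTop) ∧
      (∀ ℓ, ∀ᶠ n in atTop, ‖τ.remainder (fun n => v (φ n)) x V ℓ n‖ ≤ √(M ^ 2 + 1)) ∧
      (∀ k, ∃ b : ℕ → ℝ, Tendsto b atTop (𝓝 0) ∧ ∀ ℓ, Tendsto
        (fun n => ⨆ y, ‖⟪f k, τ.T y (τ.remainder (fun n => v (φ n)) x V ℓ n)⟫_ℂ‖) atTop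
          (𝓝 (b ℓ))) ∧
      ∀ i ℓ, Tendsto (fun n => Q i (v (φ n)) - ((∑ j ∈ Finset.range ℓ, Q i (τ.T (x j n) (V j))) +
        Q i (τ.remainder (fun n => v (φ n)) x V ℓ n))) atTop (𝓝 0) := by
  let U : Ultrafilter ℕ := hyperfilter ℕ
  have hU : (U : Filter ℕ) ≤ atTop := Nat.hyperfilter_le_atTop
  obtain ⟨x, V, hx, hw, ⟨m, hm, hmt⟩, hf⟩ := τ.exists_profile_decomposition U hU v hM
  choose b hb hbt using fun k => hf (f k)
  let l : {p : ℕ × ℕ // p.2 ≠ p.1} ⊕ ℕ ⊕ (ℕ × ℕ) ⊕ (κ × ℕ) → Filter ℝ :=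
    Sum.elim (fun _ => atTop) (Sum.elim (fun ℓ => 𝓝 (m ℓ))
      (Sum.elim (fun p => 𝓝 (b p.1 p.2)) fun _ => 𝓝 0))
  have hl : ∀ i, (l i).IsCountablyGenerated := by
    rintro (_ | _ | _ | _)
    · exact inferInstanceAs (atTop : Filter ℝ).IsCountablyGenerated
    all_goals exact inferInstanceAs (𝓝 _ : Filter ℝ).IsCountablyGenerated
  obtain ⟨φ, hφ, h⟩ := exists_strictMono_tendsto_of_ultrafilter
    (κ := {p : ℕ × ℕ // p.2 ≠ p.1} ⊕ ℕ ⊕ (ℕ × ℕ) ⊕ (κ × ℕ)) (Y := fun _ => ℝ) U hU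
    (Sum.elim (fun p n => ‖x p.1.2 n - x p.1.1 n‖)
      (Sum.elim (fun ℓ n => ‖τ.remainder v x V ℓ n‖ ^ 2)
        (Sum.elim (fun p n => ⨆ y, ‖⟪f p.1, τ.T y (τ.remainder v x V p.2 n)⟫_ℂ‖)
          (fun p n => Q p.1 (v n) - ((∑ j ∈ Finset.range p.2, Q p.1 (τ.T (x j n) (V j))) +
            Q p.1 (τ.remainder v x V p.2 n))))))
    l (by
      rintro (p | ℓ | p | p)
      · exact tendsto_norm_cobounded_atTop.comp (hx p.1.1 p.1.2 p.2)
      · exact hmt ℓ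
      · exact hbt p.1 p.2
      · exact hQ p.1 U v x V M hM hw p.2)
  refine ⟨φ, fun j n => x j (φ n), V, hφ, fun j k hjk => h (Sum.inl ⟨(j, k), hjk⟩), fun ℓ => ?_,
    fun k => ⟨b k, hb k, fun ℓ => h (Sum.inr (Sum.inr (Sum.inl (k, ℓ))))⟩,
    fun i ℓ => h (Sum.inr (Sum.inr (Sum.inr (i, ℓ))))⟩
  have h1 : Tendsto (fun n => ‖τ.remainder v x V ℓ (φ n)‖ ^ 2) atTop (𝓝 (m ℓ)) :=
    h (Sum.inr (Sum.inl ℓ))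
  filter_upwards [h1.eventually_le_const (u := M ^ 2 + 1) (by linarith [hm ℓ])] with n hn
  exact Real.le_sqrt_of_sq_le hn

end VanishingAction

/-! ### Decompositions in `H¹` -/

namespace sobolevH1

variable {d : ℕ}

/-- Sequences in `H¹` whose mollifications tend to `0` uniformly at every scale tend to `0` in the
subcritical Lebesgue spaces. -/
theorem tendsto_limsup_eLpNorm (hd : 3 ≤ d) {p : ℝ} (hp : 2 < p)
    (hp' : p < 2 * (d : ℝ) / ((d : ℝ) - 2)) {M : ℝ} {r : ℕ → ℕ → sobolevH1 d}
    (hr : ∀ ℓ, ∀ᶠ n in atTop, ‖r ℓ n‖ ≤ M)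
    (ρ : ℕ → ContDiffBump (0 : EuclideanSpace ℝ (Fin d)))
    (hρ : Tendsto (fun k => (ρ k).rOut) atTop (𝓝 0))
    (hb : ∀ k, ∃ b : ℕ → ℝ, Tendsto b atTop (𝓝 0) ∧ ∀ ℓ, Tendsto
      (fun n => ⨆ y, ‖⟪bumpVector (ρ k), (action d).T y (r ℓ n)⟫_ℂ‖) atTop (𝓝 (b ℓ))) :
    Tendsto (fun ℓ => limsup (fun n => eLpNorm (r ℓ n).1.fst (ENNReal.ofReal p) volume) atTop)
      atTop (𝓝 0) := by
  obtain ⟨s, t, A, B, hs, ht, hA, hB, h⟩ := sobolevH1.exists_eLpNorm_le hd hp hp' M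
  have hlim : ∀ {a : ℕ → ℝ} {a₀ q : ℝ} {D : ℝ≥0∞}, 0 < q → D ≠ ⊤ → Tendsto a atTop (𝓝 a₀) →
      Tendsto (fun n => ENNReal.ofReal (a n) ^ q * D) atTop (𝓝 (ENNReal.ofReal a₀ ^ q * D)) :=
    fun hq hD ha => ENNReal.Tendsto.mul_const
      ((ENNReal.continuous_rpow_const.tendsto _).comp (ENNReal.tendsto_ofReal ha)) (Or.inr hD)
  rw [ENNReal.tendsto_nhds_zero]
  intro ε hε
  have hε2 : ε / 2 ≠ 0 := (ENNReal.half_pos hε.ne').ne'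
  have hzero : ∀ {q : ℝ} {D : ℝ≥0∞}, 0 < q → ENNReal.ofReal 0 ^ q * D = 0 := fun hq => by
    rw [ENNReal.ofReal_zero, ENNReal.zero_rpow_of_pos hq, zero_mul]
  have hk := hlim ht hB hρ
  rw [hzero ht, ENNReal.tendsto_nhds_zero] at hk
  -- fix the scale first, then let the number of profiles grow
  obtain ⟨k, hk⟩ := (hk (ε / 2) (pos_iff_ne_zero.2 hε2)).exists
  obtain ⟨b, hb0, hbt⟩ := hb k
  have hℓ := hlim hs hA hb0
  rw [hzero hs, ENNReal.tendsto_nhds_zero] at hℓ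
  filter_upwards [hℓ (ε / 2) (pos_iff_ne_zero.2 hε2)] with ℓ hbℓ
  have hle : ∀ᶠ n in atTop, eLpNorm (r ℓ n).1.fst (ENNReal.ofReal p) volume ≤
      ENNReal.ofReal (⨆ y, ‖⟪bumpVector (ρ k), (action d).T y (r ℓ n)⟫_ℂ‖) ^ s * A +
        ENNReal.ofReal (ρ k).rOut ^ t * B :=
    (hr ℓ).mono fun n hn => h (r ℓ n) (ρ k) hn
  refine (limsup_le_limsup hle).trans ?_
  rw [((hlim hs hA (hbt ℓ)).add_const _).limsup_eq]
  exact (add_le_add hbℓ hk).trans_eq (ENNReal.add_halves ε)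

theorem asymptoticallyAdditive_toL2 (U : Ultrafilter ℕ) :
    (action d).AsymptoticallyAdditive (U : Filter ℕ) fun f => ‖toL2 d f‖ ^ 2 :=
  ((action d).decouples_of_commute _ (toL2 d) (translateLp ℂ) fun _ _ => rfl).asymptoticallyAdditive

theorem asymptoticallyAdditive_hardy (hd : 3 ≤ d) (c : ℝ) (U : Ultrafilter ℕ) :
    (action d).AsymptoticallyAdditive (U : Filter ℕ)
      fun f => ‖grad d f‖ ^ 2 - c * ‖hardyOp hd f‖ ^ 2 := by
  have h1 := ((action d).decouples_of_commute (U : Filter ℕ) (grad d) (translateLp _)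
    fun _ _ => rfl).asymptoticallyAdditive
  have h2 := ((action d).decouples_of_tendsto_zero U (hardyOp hd)
    (tendsto_hardyOp_translate hd)).asymptoticallyAdditive
  exact h1.sub_const_mul h2 c

theorem norm_toL2_translate (x : EuclideanSpace ℝ (Fin d)) (f : sobolevH1 d) :
    ‖toL2 d ((action d).T x f)‖ = ‖toL2 d f‖ :=
  (translateLp ℂ x).norm_map f.1.fst

/-- Remainders of pointwise representatives represent the remainders in `H¹`. -/
theorem ae_remainder {v : ℕ → EuclideanSpace ℝ (Fin d) → ℂ} {e : ℕ → sobolevH1 d}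
    (he : ∀ n, v n =ᵐ[volume] (e n).1.fst) (x : ℕ → ℕ → EuclideanSpace ℝ (Fin d))
    (V : ℕ → sobolevH1 d) (ℓ n : ℕ) :
    (fun y => v n y - ∑ j ∈ Finset.range ℓ, (V j).1.fst (y - x j n)) =ᵐ[volume]
      ((action d).remainder e x V ℓ n).1.fst := by
  induction ℓ with
  | zero => simpa using he n
  | succ ℓ ih =>
    have h := ae_sub ih (ae_translate (V ℓ) (x ℓ n))
    rw [(action d).remainder_succ ℓ n]
    simp only [Finset.sum_range_succ, ← sub_sub]
    exact h

end sobolevH1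

end

theorem theorem2p1 (d : ℕ) (hd : 3 ≤ d) (c : ℝ) (hc_pos : 0 < c)
    (hc_lt : c < ((d : ℝ) - 2) ^ 2 / 4)
    (v : ℕ → EuclideanSpace ℝ (Fin d) → ℂ)
    (hv : ∀ n, MemH1 (v n)) (hbdd : ∃ M : ℝ, ∀ n, h1Norm (v n) ≤ M) :
    ∃ (φ : ℕ → ℕ) (x : ℕ → ℕ → EuclideanSpace ℝ (Fin d))
      (V : ℕ → EuclideanSpace ℝ (Fin d) → ℂ)
      (w : ℕ → ℕ → EuclideanSpace ℝ (Fin d) → ℂ),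
      StrictMono φ ∧
      (∀ j, MemH1 (V j)) ∧
      (∀ ℓ n, MemH1 (w ℓ n)) ∧
      (∀ j k, k ≠ j → Tendsto (fun n => ‖x k n - x j n‖) atTop atTop) ∧
      (∀ ℓ n y, v (φ n) y = (∑ j ∈ Finset.range ℓ, V j (y - x j n)) + w ℓ n y) ∧
      (∀ p : ℝ, 2 < p → p < 2 * (d : ℝ) / ((d : ℝ) - 2) →
        Tendsto (fun ℓ => limsup (fun n => eLpNorm (w ℓ n) (ENNReal.ofReal p) volume) atTop)
          atTop (𝓝 0)) ∧
      (∀ ℓ, Tendsto (fun n => (∫ y, ‖v (φ n) y‖ ^ 2)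
          - ((∑ j ∈ Finset.range ℓ, ∫ y, ‖V j y‖ ^ 2) + ∫ y, ‖w ℓ n y‖ ^ 2))
          atTop (𝓝 0)) ∧
      (∀ ℓ, Tendsto (fun n => hardyFunctional c (v (φ n))
          - ((∑ j ∈ Finset.range ℓ, hardyFunctional c (fun y => V j (y - x j n)))
            + hardyFunctional c (w ℓ n)))
          atTop (𝓝 0)) := by
  obtain ⟨M, hM⟩ := hbdd
  choose e he using fun n => sobolevH1.exists_of_memH1 (hv n)
  have heM : ∀ n, ‖e n‖ ≤ M := fun n => (sobolevH1.norm_eq_h1Norm (he n)).trans_le (hM n)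
  have hX : Nontrivial (EuclideanSpace ℝ (Fin d)) :=
    Module.nontrivial_of_finrank_pos (R := ℝ) (by rw [finrank_euclideanSpace_fin]; omega)
  -- the mollification scales `1 / (k + 1)`, one test vector for each
  let ρ : ℕ → ContDiffBump (0 : EuclideanSpace ℝ (Fin d)) := fun k =>
    ⟨1 / ((k : ℝ) + 1) / 2, 1 / ((k : ℝ) + 1), half_pos Nat.one_div_pos_of_nat,
      half_lt_self Nat.one_div_pos_of_nat⟩
  have hρ : Tendsto (fun k => (ρ k).rOut) atTop (𝓝 0) := tendsto_one_div_add_atTop_nhds_zero_nat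
  obtain ⟨φ, x, V, hφ, hx, hbd, hb, hQ⟩ :=
    (sobolevH1.action d).exists_subsequence_profile_decomposition e heM
      (fun k => sobolevH1.bumpVector (ρ k))
      (fun i : Bool => bif i then fun f => ‖sobolevH1.toL2 d f‖ ^ 2 else
        fun f => ‖sobolevH1.grad d f‖ ^ 2 - c * ‖sobolevH1.hardyOp hd f‖ ^ 2)
      (by
        rintro (_ | _) U
        · exact sobolevH1.asymptoticallyAdditive_hardy hd c U
        · exact sobolevH1.asymptoticallyAdditive_toL2 U)
  have hV : ∀ j, ∫ y, ‖((V j).1.fst : EuclideanSpace ℝ (Fin d) → ℂ) y‖ ^ 2 =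
      ‖sobolevH1.toL2 d (V j)‖ ^ 2 := fun j => sobolevH1.integral_norm_sq_of_ae (ae_eq_refl _)
  have hVH : ∀ j n, hardyFunctional c (fun y => (V j).1.fst (y - x j n)) =
      ‖sobolevH1.grad d ((sobolevH1.action d).T (x j n) (V j))‖ ^ 2 -
        c * ‖sobolevH1.hardyOp hd ((sobolevH1.action d).T (x j n) (V j))‖ ^ 2 := fun j n =>
    sobolevH1.hardyFunctional_of_ae hd c (sobolevH1.ae_translate (V j) (x j n))
  have hw := sobolevH1.ae_remainder (fun n => he (φ n)) x V
  refine ⟨φ, x, fun j => (V j).1.fst,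
    fun ℓ n y => v (φ n) y - ∑ j ∈ Finset.range ℓ, (V j).1.fst (y - x j n), hφ,
    fun j => sobolevH1.memH1_of_ae (ae_eq_refl _), fun ℓ n => sobolevH1.memH1_of_ae (hw ℓ n), hx,
    fun ℓ n y => (add_sub_cancel _ _).symm, fun p hp hp' => ?_, fun ℓ => ?_, fun ℓ => ?_⟩
  · have h := sobolevH1.tendsto_limsup_eLpNorm hd hp hp' hbd ρ hρ hb
    exact h.congr fun ℓ =>
      congrArg (limsup · atTop) (funext fun n => eLpNorm_congr_ae (hw ℓ n).symm)
  · have h := hQ true ℓ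
    simp only [cond_true, sobolevH1.norm_toL2_translate, ← hV] at h
    refine h.congr fun n => ?_
    rw [sobolevH1.integral_norm_sq_of_ae (he (φ n)), sobolevH1.integral_norm_sq_of_ae (hw ℓ n)]
  · have h := hQ false ℓ
    simp only [cond_false, ← hVH] at h
    exact h.congr fun n => congrArg₂
      (fun a b : ℝ => a - ((∑ j ∈ Finset.range ℓ,
        hardyFunctional c fun y => (V j).1.fst (y - x j n)) + b))
      (sobolevH1.hardyFunctional_of_ae hd c (he (φ n))).symm
      (sobolevH1.hardyFunctional_of_ae hd c (hw ℓ n)).symm
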